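/- Let $k$ be an algebraically closed field of characteristic zero, $G$ a finite group and $\alpha:G^3\to k^*$ a normalised 3-cocycle, i.e. $\alpha(g,h,l)\,\alpha(f,gh,l)\,\alpha(f,g,h)=\alpha(fg,h,l)\,\alpha(f,g,hl)$ and $\alpha(f,g,h)=1$ whenever one of $f,g,h$ is $1$. Write ${}^fg=fgf^{-1}$ and put $$\alpha(f,g|h)=\alpha(f,g,h)^{-1}\,\alpha(f,{}^gh,g)\,\alpha({}^{fg}h,f,g)^{-1},\qquad \alpha(f|g,h)=\alpha(f,g,h)\,\alpha({}^fg,f,h)^{-1}\,\alpha({}^fg,{}^fh,f).$$ The twisted Drinfeld centre $\mathcal Z(G,\alpha)$ is the following braided monoidal category. Its objects are the finite-dimensional $G$-graded $k$-vector spaces $X=\bigoplus_g X_g$ with automorphisms $x\mapsto f.x$ $(f\in G)$ such that $f.X_g=X_{{}^fg}$ and $(fg).x=\alpha(f,g|h)\,f.(g.x)$ for $x\in X_h$; its morphisms are the linear maps preserving grading and action. The tensor product is that of graded vector spaces, with $f.(x\otimes y)=\alpha(f|g,h)\,(f.x\otimes f.y)$ for $x\in X_g$, $y\in Y_h$; the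 unit is $k$ in degree $1$ with trivial action; the associativity constraint is $x\otimes(y\otimes z)\mapsto\alpha(f,g,h)\,(x\otimes y)\otimes z$ for $x\in X_f$, $y\in Y_g$, $z\in Z_h$; the braiding is $c(x\otimes y)=f.y\otimes x$ for $x\in X_f$. A Lagrangian algebra in $\mathcal Z(G,\alpha)$ is a nonzero commutative (associative, unital) algebra $L$ such that every local right $L$-module is a (finite) direct sum of copies of the regular module $L$; a (unital) right module $\nu:M\otimes L\to M$ is local if $\nu\, c_{L,M}\,c_{M,L}=\nu$. Let $H\subset G$ be a subgroup and let $\gamma:H\times H\to k^*$ be a normalised 2-cochain with $d\gamma=\alpha|_H$, i.e. $\gamma(g,h)\,\gamma(fg,h)^{-1}\,\gamma(f,gh)\,\gamma(f,g)^{-1}=\alpha(f,g,h)$ for $f,g,h\in H$. Let $k[H,\gamma]$ be the algebra in $\mathcal Z(H,\alpha|_H)$ with basis $e_h$ in degree $h\in H$, product $e_fe_g=\gamma(f,g)e_{fg}$ and action $f.e_g=\gamma(f,g)\,\gamma({}^fg,f)^{-1}e_{{}^fg}$. For an algebra $B$ in $\mathcal Z(H,\alpha|_H)$ let $E(B)$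 be the algebra in $\mathcal Z(G,\alpha)$ whose component of degree $f\in G$ consists of the maps $a:G\to B$ with $a(x)\in B_{x^{-1}fx}$ (where $B_g=0$ for $g\notin H$) and $a(xh)=\alpha(h^{-1},x^{-1}|f)\,h^{-1}.a(x)$ for all $x\in G$, $h\in H$, with action $(g.a)(x)=\alpha(x^{-1},g|f)^{-1}a(g^{-1}x)$ for $a$ of degree $f$, product $(ab)(x)=\alpha(x^{-1}|f,g)\,a(x)b(x)$ for $a,b$ of degrees $f,g$, and unit the constant map $x\mapsto 1_B$. Put $L(H,\gamma)=E(k[H,\gamma])$. Then every Lagrangian algebra in $\mathcal Z(G,\alpha)$ is isomorphic, as an algebra in $\mathcal Z(G,\alpha)$, to $L(H,\gamma)$ for some subgroup $H\subset G$ and some normalised $\gamma\in C^2(H,k^*)$ with $d\gamma=\alpha|_H$. -/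

import Mathlib

universe u

noncomputable section

namespace TwistedCentre

open CategoryTheory MonoidalCategory TensorProduct

/-- Normalised 3-cocycles of `G` with values in the multiplicative group of `k`. -/
structure Cocycle₃ (G k : Type u) [Group G] [Field k] where
  toFun : G → G → G → kˣ
  cocycle : ∀ f g h l, toFun g h l * toFun f (g * h) l * toFun f g h =
    toFun (f * g) h l * toFun f g (h * l)
  one_left : ∀ g h, toFun 1 g h = 1
  one_mid : ∀ f h, toFun f 1 h = 1
  one_right : ∀ f g, toFun f g 1 = 1

namespace Cocycle₃

variable {G k : Type u} [Group G] [Field k]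

instance : CoeFun (Cocycle₃ G k) (fun _ => G → G → G → kˣ) := ⟨Cocycle₃.toFun⟩

/-- The restriction of a 3-cocycle to a subgroup. -/
def restrict (α : Cocycle₃ G k) (H : Subgroup G) : Cocycle₃ H k where
  toFun f g h := α f g h
  cocycle f g h l := α.cocycle f g h l
  one_left g h := α.one_left g h
  one_mid f h := α.one_mid f h
  one_right f g := α.one_right f g

variable (α : Cocycle₃ G k)

/-- `α(f,g|h) = α(f,g,h)⁻¹ α(f,ghg⁻¹,g) α(fgh(fg)⁻¹,f,g)⁻¹`. -/
def slant (f g h : G) : kˣ :=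
  (α f g h)⁻¹ * α f (g * h * g⁻¹) g * (α (f * g * h * (f * g)⁻¹) f g)⁻¹

/-- `α(f|g,h) = α(f,g,h) α(fgf⁻¹,f,h)⁻¹ α(fgf⁻¹,fhf⁻¹,f)`. -/
def coslant (f g h : G) : kˣ :=
  α f g h * (α (f * g * f⁻¹) f h)⁻¹ * α (f * g * f⁻¹) (f * h * f⁻¹) f

lemma slant_slant (f g h v : G) :
    α.slant f (g * h) v * α.slant g h v = α.slant (f * g) h v * α.slant f g (h * v * h⁻¹) := by
  have h1 := congrArg Additive.ofMul (α.cocycle f g h v)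
  have h2 := congrArg Additive.ofMul (α.cocycle f g (h * v * h⁻¹) h)
  have h3 := congrArg Additive.ofMul (α.cocycle f (g * h * v * (g * h)⁻¹) g h)
  have h4 := congrArg Additive.ofMul (α.cocycle (f * g * h * v * (f * g * h)⁻¹) f g h)
  apply Additive.ofMul.injective
  simp only [slant, ofMul_mul, ofMul_inv, mul_assoc, mul_inv_rev, inv_mul_cancel, mul_one] at *
  linear_combination (norm := abel) h2 - h1 - h3 + h4

lemma coslant_slant (f g v w : G) :
    α.coslant (f * g) v w * α.slant f g v * α.slant f g w =
      α.slant f g (v * w) * α.coslant g v w * α.coslant f (g * v * g⁻¹) (g * w * g⁻¹) := by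
  have h1 := congrArg Additive.ofMul (α.cocycle f g v w)
  have h2 := congrArg Additive.ofMul (α.cocycle f (g * v * g⁻¹) g w)
  have h3 := congrArg Additive.ofMul (α.cocycle (f * g * v * (f * g)⁻¹) f g w)
  have h4 := congrArg Additive.ofMul (α.cocycle f (g * v * g⁻¹) (g * w * g⁻¹) g)
  have h5 := congrArg Additive.ofMul
    (α.cocycle (f * g * v * (f * g)⁻¹) f (g * w * g⁻¹) g)
  have h6 := congrArg Additive.ofMul
    (α.cocycle (f * g * v * (f * g)⁻¹) (f * g * w * (f * g)⁻¹) f g)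
  apply Additive.ofMul.injective
  simp only [slant, coslant, ofMul_mul, ofMul_inv, mul_assoc, mul_inv_rev, inv_mul_cancel,
    inv_mul_cancel_left, mul_one] at *
  linear_combination (norm := abel) h2 - h1 - h3 - h4 + h5 - h6

lemma coslant_coslant (f g h v : G) :
    α g h v * α.coslant f (g * h) v * α.coslant f g h =
      α.coslant f g (h * v) * α.coslant f h v * α (f * g * f⁻¹) (f * h * f⁻¹) (f * v * f⁻¹) := by
  have h1 := congrArg Additive.ofMul (α.cocycle f g h v)
  have h2 := congrArg Additive.ofMul (α.cocycle (f * g * f⁻¹) f h v)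
  have h3 := congrArg Additive.ofMul (α.cocycle (f * g * f⁻¹) (f * h * f⁻¹) f v)
  have h4 := congrArg Additive.ofMul (α.cocycle (f * g * f⁻¹) (f * h * f⁻¹) (f * v * f⁻¹) f)
  apply Additive.ofMul.injective
  simp only [coslant, ofMul_mul, ofMul_inv, mul_assoc, inv_mul_cancel,
    inv_mul_cancel_left, mul_one] at *
  linear_combination (norm := abel) h1 - h2 + h3 - h4

lemma coslant_mul_slant (f g h : G) :
    α.coslant f g h * α.slant f g h =
      α.coslant f (g * h * g⁻¹) g * α.slant (f * g * f⁻¹) f h := by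
  apply Additive.ofMul.injective
  simp only [slant, coslant, ofMul_mul, ofMul_inv, mul_assoc, mul_inv_rev, inv_mul_cancel, mul_one]
  abel

@[simp] lemma slant_one_left (g h : G) : α.slant 1 g h = 1 := by
  simp [slant, α.one_left, α.one_mid]
@[simp] lemma slant_one_mid (f h : G) : α.slant f 1 h = 1 := by
  simp [slant, α.one_right, α.one_mid]
@[simp] lemma slant_one_right (f g : G) : α.slant f g 1 = 1 := by
  simp [slant, α.one_left, α.one_right, α.one_mid]
@[simp] lemma coslant_one_left (g h : G) : α.coslant 1 g h = 1 := by
  simp [coslant, α.one_left, α.one_right, α.one_mid]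
@[simp] lemma coslant_one_mid (f h : G) : α.coslant f 1 h = 1 := by
  simp [coslant, α.one_left, α.one_mid]
@[simp] lemma coslant_one_right (f g : G) : α.coslant f g 1 = 1 := by
  simp [coslant, α.one_right, α.one_mid]

end Cocycle₃
/-! ### Gradings, given by their families of projections -/

section Grading

variable {G k V W X : Type*} [Field k]
  [AddCommGroup V] [Module k V] [AddCommGroup W] [Module k W] [AddCommGroup X] [Module k X]

/-- The vector `v` is homogeneous of degree `g` with respect to the grading with projections `π`. -/
def IsHomog (π : G → Module.End k V) (g : G) (v : V) : Prop := π g v = v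

lemma IsHomog.smul {π : G → Module.End k V} {g : G} {v : V} (hv : IsHomog π g v) (c : k) :
    IsHomog π g (c • v) := by
  rw [IsHomog, map_smul, hv]

lemma IsHomog.zero (π : G → Module.End k V) (g : G) : IsHomog π g 0 := map_zero _

variable [Fintype G] {π : G → Module.End k V} {σ : G → Module.End k W} {ρ : G → Module.End k X}

lemma isHomog_proj (hπ : CompleteOrthogonalIdempotents π) (g : G) (v : V) :
    IsHomog π g (π g v) :=
  LinearMap.congr_fun (hπ.idem g).eq v

open scoped Classical in
lemma IsHomog.proj_eq (hπ : CompleteOrthogonalIdempotents π) {g : G} {v : V}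
    (hv : IsHomog π g v) (h : G) : π h v = if h = g then v else 0 := by
  split_ifs with e
  · rw [e, hv]
  · rw [← hv]
    exact LinearMap.congr_fun (hπ.ortho e) v

lemma sum_proj (hπ : CompleteOrthogonalIdempotents π) (v : V) : ∑ g, π g v = v := by
  have := LinearMap.congr_fun hπ.complete v
  simpa using this

lemma hext (hπ : CompleteOrthogonalIdempotents π) {φ ψ : V →ₗ[k] W}
    (h : ∀ g v, IsHomog π g v → φ v = ψ v) : φ = ψ := by
  ext v
  rw [← sum_proj hπ v, map_sum, map_sum]
  exact Finset.sum_congr rfl fun g _ => h g _ (isHomog_proj hπ g v)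

lemma hext₂ (hπ : CompleteOrthogonalIdempotents π) (hσ : CompleteOrthogonalIdempotents σ)
    {φ ψ : V ⊗[k] W →ₗ[k] X}
    (h : ∀ g v, IsHomog π g v → ∀ g' w, IsHomog σ g' w → φ (v ⊗ₜ w) = ψ (v ⊗ₜ w)) : φ = ψ := by
  apply TensorProduct.ext
  apply hext hπ
  intro g v hv
  apply hext hσ
  intro g' w hw
  exact h g v hv g' w hw

/-- A linear map that changes degrees by an injective map `c` intertwines the projections. -/
lemma comm_proj (hπ : CompleteOrthogonalIdempotents π) (hσ : CompleteOrthogonalIdempotents σ)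
    (φ : V →ₗ[k] W) (c : G → G) (hc : Function.Injective c)
    (h : ∀ g v, IsHomog π g v → IsHomog σ (c g) (φ v)) (g : G) (v : V) :
    φ (π g v) = σ (c g) (φ v) := by
  classical
  refine LinearMap.congr_fun (f := φ ∘ₗ π g) (g := σ (c g) ∘ₗ φ) (hext hπ ?_) v
  intro g' w hw
  simp only [LinearMap.comp_apply]
  rw [hw.proj_eq hπ, (h g' w hw).proj_eq hσ]
  simp only [hc.eq_iff]
  split_ifs <;> simp

variable [Group G]

/-- The grading of a tensor product: `(V ⊗ W)_f = ⨁_{gh = f} V_g ⊗ W_h`. -/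
def tensorProj (π : G → Module.End k V) (σ : G → Module.End k W) (f : G) :
    Module.End k (V ⊗[k] W) :=
  ∑ g, TensorProduct.map (π g) (σ (g⁻¹ * f))

open scoped Classical in
lemma tensorProj_tmul (hπ : CompleteOrthogonalIdempotents π)
    (hσ : CompleteOrthogonalIdempotents σ) {g h : G} {v : V} {w : W}
    (hv : IsHomog π g v) (hw : IsHomog σ h w) (f : G) :
    tensorProj π σ f (v ⊗ₜ w) = if f = g * h then v ⊗ₜ w else 0 := by
  simp only [tensorProj, LinearMap.sum_apply, TensorProduct.map_tmul, hv.proj_eq hπ,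
    hw.proj_eq hσ]
  rw [Finset.sum_eq_single g]
  · simp only [if_true, inv_mul_eq_iff_eq_mul]
    split_ifs <;> simp
  · intro b _ hb
    simp [hb]
  · simp

lemma IsHomog.tmul (hπ : CompleteOrthogonalIdempotents π)
    (hσ : CompleteOrthogonalIdempotents σ) {g h : G} {v : V} {w : W}
    (hv : IsHomog π g v) (hw : IsHomog σ h w) : IsHomog (tensorProj π σ) (g * h) (v ⊗ₜ w) := by
  classical
  rw [IsHomog, tensorProj_tmul hπ hσ hv hw, if_pos rfl]

lemma tensorProj_grading (hπ : CompleteOrthogonalIdempotents π)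
    (hσ : CompleteOrthogonalIdempotents σ) :
    CompleteOrthogonalIdempotents (tensorProj π σ) := by
  classical
  rw [CompleteOrthogonalIdempotents.iff_ortho_complete]
  constructor
  · intro f f' hf
    refine hext₂ hπ hσ fun g v hv h w hw => ?_
    simp only [Module.End.mul_apply, tensorProj_tmul hπ hσ hv hw, LinearMap.zero_apply]
    split_ifs with e
    · rw [tensorProj_tmul hπ hσ hv hw, if_neg (by rw [← e]; exact hf)]
    · simp
  · refine hext₂ hπ hσ fun g v hv h w hw => ?_
    simp [LinearMap.sum_apply, tensorProj_tmul hπ hσ hv hw]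

/-- A linear map out of `V ⊗ W` that changes the degrees of homogeneous tensors by an injective
map `c` intertwines the projections. -/
lemma comm_proj₂ {τ : G → Module.End k X} (hπ : CompleteOrthogonalIdempotents π)
    (hσ : CompleteOrthogonalIdempotents σ) (hτ : CompleteOrthogonalIdempotents τ)
    (φ : V ⊗[k] W →ₗ[k] X) (c : G → G) (hc : Function.Injective c)
    (h : ∀ g v, IsHomog π g v → ∀ g' w, IsHomog σ g' w → IsHomog τ (c (g * g')) (φ (v ⊗ₜ w)))
    (f : G) (t : V ⊗[k] W) :
    φ (tensorProj π σ f t) = τ (c f) (φ t) := by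
  classical
  refine LinearMap.congr_fun (f := φ ∘ₗ tensorProj π σ f) (g := τ (c f) ∘ₗ φ) (hext₂ hπ hσ ?_) t
  intro g v hv g' w hw
  simp only [LinearMap.comp_apply]
  rw [tensorProj_tmul hπ hσ hv hw, (h g v hv g' w hw).proj_eq hτ]
  simp only [hc.eq_iff]
  split_ifs <;> simp

end Grading

/-! ### The category `𝒵(G, α)` -/

variable {G k : Type u} [Group G] [Fintype G] [Field k]

/-- An object of `𝒵(G, α)`: a finite dimensional `G`-graded vector space with an `α`-projective
`G`-action. The grading is given by the projections `proj g` onto the homogeneous components. As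
`α` is normalised, requiring that all `act f` be automorphisms is the same as requiring
`act 1 = 1`, see `Obj.act_bijective`. -/
structure Obj (α : Cocycle₃ G k) where
  carrier : Type u
  [addCommGroup : AddCommGroup carrier]
  [module : Module k carrier]
  [finite : FiniteDimensional k carrier]
  proj : G → Module.End k carrier
  grading : CompleteOrthogonalIdempotents proj
  act : G → Module.End k carrier
  act_one : act 1 = 1
  act_proj : ∀ f g v, act f (proj g v) = proj (f * g * f⁻¹) (act f v)
  act_mul : ∀ f g h v, act (f * g) (proj h v) = (α.slant f g h : k) • act f (act g (proj h v))

namespace Obj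

variable {α : Cocycle₃ G k}

instance : CoeSort (Obj α) (Type u) := ⟨Obj.carrier⟩

attribute [instance] Obj.addCommGroup Obj.module Obj.finite

/-- `v ∈ X_g`. -/
abbrev Homog (X : Obj α) (g : G) (v : X) : Prop := IsHomog X.proj g v

lemma _root_.TwistedCentre.IsHomog.act {X : Obj α} {g : G} {v : X} (hv : X.Homog g v) (f : G) :
    X.Homog (f * g * f⁻¹) (X.act f v) := by
  rw [Homog, IsHomog, ← X.act_proj, hv]

lemma _root_.TwistedCentre.IsHomog.act_mul {X : Obj α} {h : G} {v : X} (hv : X.Homog h v) (f g : G) :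
    X.act (f * g) v = (α.slant f g h : k) • X.act f (X.act g v) := by
  have := X.act_mul f g h v
  rwa [hv] at this

lemma act_bijective (X : Obj α) (f : G) : Function.Bijective (X.act f) := by
  have key : ∀ f : G, Function.Injective (X.act f) := by
    intro f
    rw [injective_iff_map_eq_zero]
    intro v hv
    rw [← sum_proj X.grading v]
    refine Finset.sum_eq_zero fun g _ => ?_
    have h1 := X.act_mul f⁻¹ f g v
    rw [inv_mul_cancel, X.act_one, X.act_proj f, hv, map_zero, map_zero, smul_zero] at h1
    exact h1
  exact ⟨key f, (LinearMap.injective_iff_surjective).1 (key f)⟩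

/-- Morphisms of `𝒵(G, α)`: linear maps preserving the grading and the action. -/
@[ext] structure Hom (X Y : Obj α) where
  lin : X →ₗ[k] Y
  map_proj : ∀ g v, lin (X.proj g v) = Y.proj g (lin v)
  map_act : ∀ f v, lin (X.act f v) = Y.act f (lin v)

instance : Category (Obj α) where
  Hom := Hom
  id X := ⟨LinearMap.id, fun _ _ => rfl, fun _ _ => rfl⟩
  comp φ ψ := ⟨ψ.lin ∘ₗ φ.lin, by simp [φ.map_proj, ψ.map_proj], by simp [φ.map_act, ψ.map_act]⟩

@[ext] lemma hom_ext {X Y : Obj α} {φ ψ : X ⟶ Y} (h : Hom.lin φ = Hom.lin ψ) : φ = ψ :=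
  Hom.ext h

@[simp] lemma id_lin (X : Obj α) : Hom.lin (𝟙 X) = LinearMap.id := rfl

@[simp] lemma comp_lin {X Y Z : Obj α} (φ : X ⟶ Y) (ψ : Y ⟶ Z) :
    Hom.lin (φ ≫ ψ) = Hom.lin ψ ∘ₗ Hom.lin φ := rfl

lemma map_homog {X Y : Obj α} (φ : X ⟶ Y) {g : G} {v : X} (hv : X.Homog g v) :
    Y.Homog g (Hom.lin φ v) := by
  rw [Homog, IsHomog, ← Hom.map_proj φ, hv]

/-- A morphism from its values on homogeneous vectors. -/
def mkHom {X Y : Obj α} (φ : X →ₗ[k] Y)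
    (h₁ : ∀ g v, X.Homog g v → Y.Homog g (φ v))
    (h₂ : ∀ f g v, X.Homog g v → φ (X.act f v) = Y.act f (φ v)) : X ⟶ Y where
  lin := φ
  map_proj := comm_proj X.grading Y.grading φ id Function.injective_id h₁
  map_act f := LinearMap.congr_fun (f := φ ∘ₗ X.act f) (g := Y.act f ∘ₗ φ)
    (hext X.grading (h₂ f))

/-- A bijective morphism is an isomorphism. -/
def isoOfBijective {X Y : Obj α} (φ : X ⟶ Y) (hφ : Function.Bijective (Hom.lin φ)) : X ≅ Y where
  hom := φ
  inv :=
    { lin := (LinearEquiv.ofBijective (Hom.lin φ) hφ).symm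
      map_proj := fun g v => by
        obtain ⟨w, rfl⟩ := hφ.2 v
        rw [← Hom.map_proj φ]
        simp
      map_act := fun g v => by
        obtain ⟨w, rfl⟩ := hφ.2 v
        rw [← Hom.map_act φ]
        simp }
  hom_inv_id := by
    ext v
    simp
  inv_hom_id := by
    ext v
    simp

section Preadditive

variable (X Y : Obj α)

instance : Zero (X ⟶ Y) := ⟨⟨0, by simp, by simp⟩⟩
instance : Add (X ⟶ Y) := ⟨fun φ ψ => ⟨Hom.lin φ + Hom.lin ψ,
  by simp [Hom.map_proj], by simp [Hom.map_act]⟩⟩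
instance : Neg (X ⟶ Y) := ⟨fun φ => ⟨-Hom.lin φ, by simp [Hom.map_proj], by simp [Hom.map_act]⟩⟩
instance : Sub (X ⟶ Y) := ⟨fun φ ψ => ⟨Hom.lin φ - Hom.lin ψ,
  by simp [Hom.map_proj], by simp [Hom.map_act]⟩⟩
instance : SMul ℕ (X ⟶ Y) := ⟨fun n φ => ⟨n • Hom.lin φ,
  by simp [Hom.map_proj], by simp [Hom.map_act]⟩⟩
instance : SMul ℤ (X ⟶ Y) := ⟨fun n φ => ⟨n • Hom.lin φ,
  by simp [Hom.map_proj], by simp [Hom.map_act]⟩⟩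

instance : AddCommGroup (X ⟶ Y) :=
  Function.Injective.addCommGroup (Hom.lin : (X ⟶ Y) → (X →ₗ[k] Y)) (fun _ _ h => Hom.ext h)
    rfl (fun _ _ => rfl) (fun _ => rfl) (fun _ _ => rfl) (fun _ _ => rfl) (fun _ _ => rfl)

@[simp] lemma zero_lin : Hom.lin (0 : X ⟶ Y) = 0 := rfl
@[simp] lemma add_lin {X Y : Obj α} (φ ψ : X ⟶ Y) : Hom.lin (φ + ψ) = Hom.lin φ + Hom.lin ψ := rfl

instance : Preadditive (Obj α) where

end Preadditive

section Monoidal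

/-- The `α`-projective action on a tensor product, `f.(x ⊗ y) = α(f|g,h) (f.x ⊗ f.y)` for
`x ∈ X_g` and `y ∈ Y_h`. -/
def tensorAct (X Y : Obj α) (f : G) : Module.End k (X ⊗[k] Y) :=
  ∑ g, ∑ h, (α.coslant f g h : k) •
    TensorProduct.map (X.act f ∘ₗ X.proj g) (Y.act f ∘ₗ Y.proj h)

lemma tensorAct_tmul {X Y : Obj α} {g h : G} {x : X} {y : Y} (hx : X.Homog g x)
    (hy : Y.Homog h y) (f : G) :
    tensorAct X Y f (x ⊗ₜ y) = (α.coslant f g h : k) • (X.act f x ⊗ₜ Y.act f y) := by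
  classical
  simp only [tensorAct, LinearMap.sum_apply, LinearMap.smul_apply, TensorProduct.map_tmul,
    LinearMap.comp_apply, hx.proj_eq X.grading, hy.proj_eq Y.grading]
  rw [Finset.sum_eq_single g, Finset.sum_eq_single h] <;> simp +contextual

/-- The tensor product of `𝒵(G, α)`. -/
def tensor (X Y : Obj α) : Obj α where
  carrier := X ⊗[k] Y
  proj := tensorProj X.proj Y.proj
  grading := tensorProj_grading X.grading Y.grading
  act := tensorAct X Y
  act_one := hext₂ X.grading Y.grading fun g x hx h y hy => by
    simp [tensorAct_tmul hx hy, X.act_one, Y.act_one]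
  act_proj f g := comm_proj₂ X.grading Y.grading (tensorProj_grading X.grading Y.grading)
    (tensorAct X Y f) (fun g => f * g * f⁻¹) (MulAut.conj f).injective
    (fun g x hx h y hy => by
      rw [tensorAct_tmul hx hy]
      have := (IsHomog.tmul X.grading Y.grading (hx.act f) (hy.act f)).smul
        (α.coslant f g h : k)
      simpa [mul_assoc] using this) g
  act_mul f g h v := by
    classical
    refine LinearMap.congr_fun (f := tensorAct X Y (f * g) ∘ₗ tensorProj X.proj Y.proj h)
      (g := (α.slant f g h : k) •
        (tensorAct X Y f ∘ₗ tensorAct X Y g ∘ₗ tensorProj X.proj Y.proj h))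
      (hext₂ X.grading Y.grading ?_) v
    intro a x hx b y hy
    simp only [LinearMap.comp_apply, LinearMap.smul_apply,
      tensorProj_tmul X.grading Y.grading hx hy]
    split_ifs with e
    · subst e
      rw [tensorAct_tmul hx hy, tensorAct_tmul hx hy, map_smul,
        tensorAct_tmul (hx.act g) (hy.act g), hx.act_mul, hy.act_mul]
      simp only [TensorProduct.smul_tmul', TensorProduct.tmul_smul, smul_smul, ← Units.val_mul]
      congr 2
      rw [← mul_assoc (α.slant f g (a * b)), ← α.coslant_slant f g a b, mul_right_comm, mul_assoc]
    · simp

/-- The monoidal unit: `k` in degree `1` with the trivial action. -/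
def one (α : Cocycle₃ G k) : Obj α where
  carrier := k
  proj g := open scoped Classical in if g = 1 then 1 else 0
  grading := by
    classical
    rw [CompleteOrthogonalIdempotents.iff_ortho_complete]
    constructor
    · intro g h hgh
      by_cases hg : g = 1
      · have : h ≠ 1 := fun e => hgh (hg.trans e.symm)
        simp [this]
      · simp [hg]
    · simp
  act _ := 1
  act_one := rfl
  act_proj f g v := by
    by_cases hg : g = 1
    · simp [hg]
    · simp [hg]
  act_mul f g h v := by
    by_cases hg : h = 1
    · simp [hg]
    · simp [hg]

lemma one_homog (v : one α) : (one α).Homog 1 v := by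
  simp only [Homog, IsHomog, one, if_true]
  rfl

/-- The tensor `x ⊗ y` as an element of the object `X ⊗ Y`. -/
def tm {X Y : Obj α} (x : X) (y : Y) : tensor X Y := (x ⊗ₜ[k] y : X ⊗[k] Y)

section

variable {X Y Z T : Obj α} {f g h l : G} {x : X} {y : Y} {z : Z} {t : T}

lemma smul_tm (c : k) (x : X) (y : Y) : tm (c • x) y = c • tm x y := rfl

lemma tm_smul (c : k) (x : X) (y : Y) : tm x (c • y) = c • tm x y :=
  TensorProduct.tmul_smul c x y

lemma tm_homog (hx : X.Homog g x) (hy : Y.Homog h y) :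
    (tensor X Y).Homog (g * h) (tm x y) :=
  IsHomog.tmul X.grading Y.grading hx hy

lemma act_tm (hx : X.Homog g x) (hy : Y.Homog h y) (f : G) :
    (tensor X Y).act f (tm x y) = (α.coslant f g h : k) • tm (X.act f x) (Y.act f y) :=
  tensorAct_tmul hx hy f

variable {W : Type*} [AddCommGroup W] [Module k W]

lemma tm_ext {φ ψ : tensor X Y →ₗ[k] W}
    (H : ∀ f x, X.Homog f x → ∀ g y, Y.Homog g y → φ (tm x y) = ψ (tm x y)) : φ = ψ :=
  hext₂ X.grading Y.grading H

lemma tm_ext_left {φ ψ : tensor (tensor X Y) Z →ₗ[k] W}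
    (H : ∀ f x, X.Homog f x → ∀ g y, Y.Homog g y → ∀ h z, Z.Homog h z →
      φ (tm (tm x y) z) = ψ (tm (tm x y) z)) : φ = ψ := by
  apply TensorProduct.ext (R := k) (M := X ⊗[k] Y) (N := Z) (P₂ := W)
  refine hext₂ X.grading Y.grading fun f x hx g y hy => ?_
  refine hext Z.grading fun h z hz => ?_
  exact H f x hx g y hy h z hz

lemma tm_ext_right {φ ψ : tensor X (tensor Y Z) →ₗ[k] W}
    (H : ∀ f x, X.Homog f x → ∀ g y, Y.Homog g y → ∀ h z, Z.Homog h z →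
      φ (tm x (tm y z)) = ψ (tm x (tm y z))) : φ = ψ := by
  apply TensorProduct.ext (R := k) (M := X) (N := Y ⊗[k] Z) (P₂ := W)
  refine hext X.grading fun f x hx => ?_
  refine hext₂ Y.grading Z.grading fun g y hy h z hz => ?_
  exact H f x hx g y hy h z hz

lemma tm_ext_four {φ ψ : tensor (tensor (tensor X Y) Z) T →ₗ[k] W}
    (H : ∀ f x, X.Homog f x → ∀ g y, Y.Homog g y → ∀ h z, Z.Homog h z → ∀ l t, T.Homog l t →
      φ (tm (tm (tm x y) z) t) = ψ (tm (tm (tm x y) z) t)) : φ = ψ := by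
  apply TensorProduct.ext (R := k) (M := (X ⊗[k] Y) ⊗[k] Z) (N := T) (P₂ := W)
  refine tm_ext_left (X := X) (Y := Y) (Z := Z) fun f x hx g y hy h z hz => ?_
  refine hext T.grading fun l t ht => ?_
  exact H f x hx g y hy h z hz l t ht

end

/-- A morphism out of a tensor product from its values on homogeneous tensors. -/
def mkHom₂ {X Y Z : Obj α} (φ : X ⊗[k] Y →ₗ[k] Z)
    (h₁ : ∀ g x, X.Homog g x → ∀ h y, Y.Homog h y → Z.Homog (g * h) (φ (x ⊗ₜ y)))
    (h₂ : ∀ f g x, X.Homog g x → ∀ h y, Y.Homog h y →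
      (α.coslant f g h : k) • φ (X.act f x ⊗ₜ Y.act f y) = Z.act f (φ (x ⊗ₜ y))) :
    tensor X Y ⟶ Z where
  lin := φ
  map_proj := comm_proj₂ X.grading Y.grading Z.grading φ id Function.injective_id h₁
  map_act f := LinearMap.congr_fun (f := φ ∘ₗ tensorAct X Y f) (g := Z.act f ∘ₗ φ)
    (hext₂ X.grading Y.grading fun g x hx h y hy => by
      simp only [LinearMap.comp_apply]
      rw [tensorAct_tmul hx hy, map_smul, h₂ f g x hx h y hy])

/-- The tensor product of morphisms. -/
def tensorMor {X₁ Y₁ X₂ Y₂ : Obj α} (φ : X₁ ⟶ Y₁) (ψ : X₂ ⟶ Y₂) :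
    tensor X₁ X₂ ⟶ tensor Y₁ Y₂ :=
  mkHom₂ (Z := tensor Y₁ Y₂) (TensorProduct.map (Hom.lin φ) (Hom.lin ψ))
    (fun g x hx h y hy => tm_homog (map_homog φ hx) (map_homog ψ hy))
    (fun f g x hx h y hy => by
      change _ • tm (Hom.lin φ (X₁.act f x)) (Hom.lin ψ (X₂.act f y)) =
        (tensor Y₁ Y₂).act f (tm (Hom.lin φ x) (Hom.lin ψ y))
      rw [act_tm (map_homog φ hx) (map_homog ψ hy), Hom.map_act, Hom.map_act])

@[simp] lemma tensorMor_tm {X₁ Y₁ X₂ Y₂ : Obj α} (φ : X₁ ⟶ Y₁) (ψ : X₂ ⟶ Y₂) (x : X₁) (y : X₂) :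
    Hom.lin (tensorMor φ ψ) (tm x y) = tm (Hom.lin φ x) (Hom.lin ψ y) := rfl

/-- The associativity constraint `(X ⊗ Y) ⊗ Z → X ⊗ (Y ⊗ Z)`, the inverse of
`x ⊗ (y ⊗ z) ↦ α(f,g,h) (x ⊗ y) ⊗ z` for `x ∈ X_f`, `y ∈ Y_g`, `z ∈ Z_h`. -/
def assocLin (X Y Z : Obj α) : tensor (tensor X Y) Z →ₗ[k] tensor X (tensor Y Z) :=
  (∑ f, ∑ g, ∑ h, ((α f g h)⁻¹ : kˣ).val •
    (TensorProduct.map (X.proj f) (TensorProduct.map (Y.proj g) (Z.proj h)) ∘ₗ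
      (TensorProduct.assoc k X Y Z).toLinearMap) :
    (X ⊗[k] Y) ⊗[k] Z →ₗ[k] X ⊗[k] (Y ⊗[k] Z))

/-- The associativity constraint `x ⊗ (y ⊗ z) ↦ α(f,g,h) (x ⊗ y) ⊗ z` for `x ∈ X_f`, `y ∈ Y_g`,
`z ∈ Z_h`. -/
def assocInvLin (X Y Z : Obj α) : tensor X (tensor Y Z) →ₗ[k] tensor (tensor X Y) Z :=
  (∑ f, ∑ g, ∑ h, (α f g h : k) •
    (TensorProduct.map (TensorProduct.map (X.proj f) (Y.proj g)) (Z.proj h) ∘ₗ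
      (TensorProduct.assoc k X Y Z).symm.toLinearMap) :
    X ⊗[k] (Y ⊗[k] Z) →ₗ[k] (X ⊗[k] Y) ⊗[k] Z)

section

variable {X Y Z : Obj α} {f g h : G} {x : X} {y : Y} {z : Z}

lemma assocLin_tm (hx : X.Homog f x) (hy : Y.Homog g y) (hz : Z.Homog h z) :
    assocLin X Y Z (tm (tm x y) z) = ((α f g h)⁻¹ : kˣ).val • tm x (tm y z) := by
  classical
  change (∑ f, ∑ g, ∑ h, ((α f g h)⁻¹ : kˣ).val •
    (TensorProduct.map (X.proj f) (TensorProduct.map (Y.proj g) (Z.proj h)) ∘ₗ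
      (TensorProduct.assoc k X Y Z).toLinearMap) :
    (X ⊗[k] Y) ⊗[k] Z →ₗ[k] X ⊗[k] (Y ⊗[k] Z)) ((x ⊗ₜ[k] y) ⊗ₜ[k] z) =
      ((α f g h)⁻¹ : kˣ).val • (x ⊗ₜ[k] (y ⊗ₜ[k] z))
  simp only [LinearMap.sum_apply, LinearMap.smul_apply, TensorProduct.map_tmul,
    LinearMap.comp_apply, LinearEquiv.coe_coe, TensorProduct.assoc_tmul,
    hx.proj_eq X.grading, hy.proj_eq Y.grading, hz.proj_eq Z.grading]
  rw [Finset.sum_eq_single f, Finset.sum_eq_single g, Finset.sum_eq_single h] <;>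
    simp +contextual

lemma assocInvLin_tm (hx : X.Homog f x) (hy : Y.Homog g y) (hz : Z.Homog h z) :
    assocInvLin X Y Z (tm x (tm y z)) = (α f g h : k) • tm (tm x y) z := by
  classical
  change (∑ f, ∑ g, ∑ h, (α f g h : k) •
    (TensorProduct.map (TensorProduct.map (X.proj f) (Y.proj g)) (Z.proj h) ∘ₗ
      (TensorProduct.assoc k X Y Z).symm.toLinearMap) :
    X ⊗[k] (Y ⊗[k] Z) →ₗ[k] (X ⊗[k] Y) ⊗[k] Z) (x ⊗ₜ[k] (y ⊗ₜ[k] z)) =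
      (α f g h : k) • ((x ⊗ₜ[k] y) ⊗ₜ[k] z)
  simp only [LinearMap.sum_apply, LinearMap.smul_apply, TensorProduct.map_tmul,
    LinearMap.comp_apply, LinearEquiv.coe_coe, TensorProduct.assoc_symm_tmul,
    hx.proj_eq X.grading, hy.proj_eq Y.grading, hz.proj_eq Z.grading]
  rw [Finset.sum_eq_single f, Finset.sum_eq_single g, Finset.sum_eq_single h] <;>
    simp +contextual

end

/-- The associativity constraint as a morphism. -/
def assocHom (X Y Z : Obj α) : tensor (tensor X Y) Z ⟶ tensor X (tensor Y Z) where
  lin := assocLin X Y Z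
  map_proj e t := by
    classical
    refine LinearMap.congr_fun (f := assocLin X Y Z ∘ₗ (tensor (tensor X Y) Z).proj e)
      (g := (tensor X (tensor Y Z)).proj e ∘ₗ assocLin X Y Z) (tm_ext_left ?_) t
    intro f x hx g y hy h z hz
    simp only [LinearMap.comp_apply]
    rw [assocLin_tm hx hy hz, map_smul,
      (tm_homog (tm_homog hx hy) hz).proj_eq (tensor (tensor X Y) Z).grading,
      (tm_homog hx (tm_homog hy hz)).proj_eq (tensor X (tensor Y Z)).grading, mul_assoc]
    split_ifs
    · exact assocLin_tm hx hy hz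
    · simp
  map_act e t := by
    refine LinearMap.congr_fun (f := assocLin X Y Z ∘ₗ (tensor (tensor X Y) Z).act e)
      (g := (tensor X (tensor Y Z)).act e ∘ₗ assocLin X Y Z) (tm_ext_left ?_) t
    intro f x hx g y hy h z hz
    simp only [LinearMap.comp_apply]
    rw [assocLin_tm hx hy hz, map_smul, act_tm (tm_homog hx hy) hz,
      act_tm hx hy, act_tm hx (tm_homog hy hz), act_tm hy hz]
    simp only [tm_smul, smul_tm, map_smul, assocLin_tm (hx.act e) (hy.act e) (hz.act e)]
    simp only [smul_smul, ← Units.val_mul]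
    congr 2
    rw [← mul_assoc, eq_inv_mul_iff_mul_eq, ← mul_assoc, ← mul_assoc, α.coslant_coslant e f g h,
      mul_inv_cancel_right]

/-- The associativity isomorphism. -/
def assocIso (X Y Z : Obj α) : tensor (tensor X Y) Z ≅ tensor X (tensor Y Z) :=
  isoOfBijective (assocHom X Y Z) <| by
    have h₁ : assocInvLin X Y Z ∘ₗ assocLin X Y Z = LinearMap.id := tm_ext_left
      fun f x hx g y hy h z hz => by
        simp [assocLin_tm hx hy hz, assocInvLin_tm hx hy hz, smul_smul]
    have h₂ : assocLin X Y Z ∘ₗ assocInvLin X Y Z = LinearMap.id := tm_ext_right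
      fun f x hx g y hy h z hz => by
        simp [assocLin_tm hx hy hz, assocInvLin_tm hx hy hz, smul_smul]
    exact Function.bijective_iff_has_inverse.2
      ⟨assocInvLin X Y Z, LinearMap.congr_fun h₁, LinearMap.congr_fun h₂⟩

lemma assocIso_hom_tm {X Y Z : Obj α} {f g h : G} {x : X} {y : Y} {z : Z}
    (hx : X.Homog f x) (hy : Y.Homog g y) (hz : Z.Homog h z) :
    Hom.lin (assocIso X Y Z).hom (tm (tm x y) z) = ((α f g h)⁻¹ : kˣ).val • tm x (tm y z) :=
  assocLin_tm hx hy hz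

lemma assocIso_inv_tm {X Y Z : Obj α} {f g h : G} {x : X} {y : Y} {z : Z}
    (hx : X.Homog f x) (hy : Y.Homog g y) (hz : Z.Homog h z) :
    Hom.lin (assocIso X Y Z).inv (tm x (tm y z)) = (α f g h : k) • tm (tm x y) z := by
  have h := LinearMap.congr_fun (congrArg Hom.lin (assocIso X Y Z).hom_inv_id) (tm (tm x y) z)
  simp only [comp_lin, LinearMap.comp_apply, assocIso_hom_tm hx hy hz, map_smul, id_lin,
    LinearMap.id_apply] at h
  rw [← h, smul_smul, Units.mul_inv, one_smul]

lemma eq_one_or_eq_zero {g : G} {c : one α} (hc : (one α).Homog g c) : g = 1 ∨ c = 0 := by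
  classical
  by_cases hg : g = 1
  · exact Or.inl hg
  · have h := hc.proj_eq (one α).grading 1
    rw [if_neg (Ne.symm hg), one_homog c] at h
    exact Or.inr h

/-- The left unit isomorphism `k ⊗ X ≅ X`. -/
def lunitIso (X : Obj α) : tensor (one α) X ≅ X :=
  isoOfBijective
    (mkHom₂ (X := one α) (TensorProduct.lid k X).toLinearMap
      (fun g c hc h x hx => by
        obtain rfl | rfl := eq_one_or_eq_zero hc
        · rw [one_mul]
          exact hx.smul c
        · rw [TensorProduct.zero_tmul]
          exact (map_zero (TensorProduct.lid k X)).symm ▸ IsHomog.zero X.proj _)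
      (fun f g c hc h x hx => by
        obtain rfl | rfl := eq_one_or_eq_zero hc
        · rw [α.coslant_one_mid, Units.val_one, one_smul]
          exact (map_smul (X.act f) (show k from c) x).symm
        · rw [map_zero, TensorProduct.zero_tmul, TensorProduct.zero_tmul]
          have h0 := map_zero (TensorProduct.lid k X)
          exact (congrArg _ h0).trans
            ((smul_zero _).trans ((congrArg (X.act f) h0).trans (map_zero _)).symm)))
    (TensorProduct.lid k X).bijective

/-- The right unit isomorphism `X ⊗ k ≅ X`. -/
def runitIso (X : Obj α) : tensor X (one α) ≅ X :=
  isoOfBijective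
    (mkHom₂ (Y := one α) (TensorProduct.rid k X).toLinearMap
      (fun h x hx g c hc => by
        obtain rfl | rfl := eq_one_or_eq_zero hc
        · rw [mul_one]
          exact hx.smul c
        · rw [TensorProduct.tmul_zero]
          exact (map_zero (TensorProduct.rid k X)).symm ▸ IsHomog.zero X.proj _)
      (fun f h x hx g c hc => by
        obtain rfl | rfl := eq_one_or_eq_zero hc
        · rw [α.coslant_one_right, Units.val_one, one_smul]
          exact (map_smul (X.act f) (show k from c) x).symm
        · rw [map_zero, TensorProduct.tmul_zero, TensorProduct.tmul_zero]
          have h0 := map_zero (TensorProduct.rid k X)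
          exact (congrArg _ h0).trans
            ((smul_zero _).trans ((congrArg (X.act f) h0).trans (map_zero _)).symm)))
    (TensorProduct.rid k X).bijective

lemma lunitIso_tm (X : Obj α) (c : k) (x : X) :
    Hom.lin (lunitIso X).hom (tm (X := one α) c x) = c • x := rfl

lemma runitIso_tm (X : Obj α) (c : k) (x : X) :
    Hom.lin (runitIso X).hom (tm (Y := one α) x c) = c • x := rfl

lemma assoc_natural {X₁ X₂ X₃ Y₁ Y₂ Y₃ : Obj α} (φ₁ : X₁ ⟶ Y₁) (φ₂ : X₂ ⟶ Y₂) (φ₃ : X₃ ⟶ Y₃) :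
    tensorMor (tensorMor φ₁ φ₂) φ₃ ≫ (assocIso Y₁ Y₂ Y₃).hom =
      (assocIso X₁ X₂ X₃).hom ≫ tensorMor φ₁ (tensorMor φ₂ φ₃) :=
  hom_ext <| tm_ext_left fun f x hx g y hy h z hz => by
    simp only [comp_lin, LinearMap.comp_apply, tensorMor_tm, assocIso_hom_tm hx hy hz, map_smul,
      assocIso_hom_tm (map_homog φ₁ hx) (map_homog φ₂ hy) (map_homog φ₃ hz)]

lemma assoc_pentagon (W X Y Z : Obj α) :
    tensorMor (assocIso W X Y).hom (𝟙 Z) ≫ (assocIso W (tensor X Y) Z).hom ≫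
      tensorMor (𝟙 W) (assocIso X Y Z).hom =
        (assocIso (tensor W X) Y Z).hom ≫ (assocIso W X (tensor Y Z)).hom :=
  hom_ext <| tm_ext_four fun f w hw g x hx h y hy l z hz => by
    simp only [comp_lin, LinearMap.comp_apply, tensorMor_tm, assocIso_hom_tm hw hx hy, map_smul,
      assocIso_hom_tm (tm_homog hw hx) hy hz, assocIso_hom_tm hw hx (tm_homog hy hz),
      assocIso_hom_tm hw (tm_homog hx hy) hz, assocIso_hom_tm hx hy hz, smul_tm, tm_smul,
      smul_smul, id_lin, LinearMap.id_apply, ← Units.val_mul]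
    congr 2
    rw [← mul_inv, ← mul_inv, ← mul_inv, ← α.cocycle f g h l]
    congr 1
    ac_rfl

lemma unit_triangle (X Y : Obj α) :
    (assocIso X (one α) Y).hom ≫ tensorMor (𝟙 X) (lunitIso Y).hom =
      tensorMor (runitIso X).hom (𝟙 Y) :=
  hom_ext <| tm_ext_left fun f x hx g c hc h y hy => by
    simp only [comp_lin, LinearMap.comp_apply]
    rw [assocIso_hom_tm hx (one_homog c) hy, α.one_mid, inv_one, Units.val_one, one_smul]
    simp only [tensorMor_tm, id_lin, LinearMap.id_apply]
    exact (congrArg (tm x) (lunitIso_tm Y c y)).trans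
      ((tm_smul (show k from c) x y).trans (congrArg (fun v => tm v y) (runitIso_tm X c x)).symm)

/-- The braiding `c(x ⊗ y) = f.y ⊗ x` for `x ∈ X_f`. -/
def braidLin (X Y : Obj α) : X ⊗[k] Y →ₗ[k] tensor Y X :=
  (∑ f, TensorProduct.map (Y.act f) (X.proj f) ∘ₗ (TensorProduct.comm k X Y).toLinearMap :
    X ⊗[k] Y →ₗ[k] Y ⊗[k] X)

lemma braidLin_tm {X Y : Obj α} {f : G} {x : X} (hx : X.Homog f x) (y : Y) :
    braidLin X Y (x ⊗ₜ y) = tm (Y.act f y) x := by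
  classical
  change (∑ f, TensorProduct.map (Y.act f) (X.proj f) ∘ₗ (TensorProduct.comm k X Y).toLinearMap :
    X ⊗[k] Y →ₗ[k] Y ⊗[k] X) (x ⊗ₜ[k] y) = Y.act f y ⊗ₜ[k] x
  simp only [LinearMap.sum_apply, TensorProduct.map_tmul,
    LinearMap.comp_apply, LinearEquiv.coe_coe, TensorProduct.comm_tmul, hx.proj_eq X.grading]
  rw [Finset.sum_eq_single f] <;> simp +contextual

/-- The braiding as a morphism. -/
def braidHom (X Y : Obj α) : tensor X Y ⟶ tensor Y X :=
  mkHom₂ (braidLin X Y)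
    (fun g x hx h y hy => by
      rw [braidLin_tm hx]
      simpa using tm_homog (hy.act g) hx)
    (fun f g x hx h y hy => by
      rw [braidLin_tm hx, braidLin_tm (hx.act f), act_tm (hy.act g) hx]
      have h1 := hy.act_mul (f * g * f⁻¹) f
      have h2 := hy.act_mul f g
      rw [inv_mul_cancel_right, h2] at h1
      have h3 : Y.act (f * g * f⁻¹) (Y.act f y) =
          ((α.slant (f * g * f⁻¹) f h)⁻¹ * α.slant f g h : kˣ).val • Y.act f (Y.act g y) := by
        rw [Units.val_mul, mul_smul, h1, smul_smul, Units.inv_mul, one_smul]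
      rw [h3, smul_tm, smul_smul, ← Units.val_mul]
      congr 2
      rw [mul_left_comm, α.coslant_mul_slant, mul_comm, mul_inv_cancel_right])

/-- The braiding isomorphism. -/
def braidIso (X Y : Obj α) : tensor X Y ≅ tensor Y X :=
  isoOfBijective (braidHom X Y) <| by
    have hs : Function.Surjective (Hom.lin (braidHom X Y)) := by
      rw [← LinearMap.range_eq_top, ← Submodule.ker_mkQ (LinearMap.range (braidHom X Y).lin),
        LinearMap.ker_eq_top]
      refine tm_ext fun g y _ f x hx => ?_
      obtain ⟨y', rfl⟩ := (Y.act_bijective f).2 y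
      rw [LinearMap.zero_apply, Submodule.mkQ_apply, Submodule.Quotient.mk_eq_zero]
      exact ⟨tm x y', braidLin_tm hx y'⟩
    refine ⟨(LinearMap.injective_iff_surjective_of_finrank_eq_finrank ?_).2 hs, hs⟩
    exact (TensorProduct.comm k X Y).finrank_eq

lemma braidIso_tm {X Y : Obj α} {f : G} {x : X} (hx : X.Homog f x) (y : Y) :
    Hom.lin (braidIso X Y).hom (tm x y) = tm (Y.act f y) x :=
  braidLin_tm hx y

lemma braid_natural {X₁ X₂ Y₁ Y₂ : Obj α} (φ : X₁ ⟶ Y₁) (ψ : X₂ ⟶ Y₂) :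
    tensorMor φ ψ ≫ (braidIso Y₁ Y₂).hom = (braidIso X₁ X₂).hom ≫ tensorMor ψ φ :=
  hom_ext <| tm_ext fun f x hx g y hy => by
    simp only [comp_lin, LinearMap.comp_apply, tensorMor_tm, braidIso_tm hx,
      braidIso_tm (map_homog φ hx), Hom.map_act]

lemma braid_hexagon_forward (X Y Z : Obj α) :
    (assocIso X Y Z).hom ≫ (braidIso X (tensor Y Z)).hom ≫ (assocIso Y Z X).hom =
      tensorMor (braidIso X Y).hom (𝟙 Z) ≫ (assocIso Y X Z).hom ≫
        tensorMor (𝟙 Y) (braidIso X Z).hom :=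
  hom_ext <| tm_ext_left fun f x hx g y hy h z hz => by
    simp only [comp_lin, LinearMap.comp_apply, tensorMor_tm, assocIso_hom_tm hx hy hz, map_smul,
      braidIso_tm hx, act_tm hy hz, assocIso_hom_tm (hy.act f) hx hz,
      assocIso_hom_tm (hy.act f) (hz.act f) hx, smul_tm,
      smul_smul, id_lin, LinearMap.id_apply, ← Units.val_mul]
    congr 2
    rw [Cocycle₃.coslant]
    simp [mul_assoc]

lemma braid_hexagon_reverse (X Y Z : Obj α) :
    (assocIso X Y Z).inv ≫ (braidIso (tensor X Y) Z).hom ≫ (assocIso Z X Y).inv =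
      tensorMor (𝟙 X) (braidIso Y Z).hom ≫ (assocIso X Z Y).inv ≫
        tensorMor (braidIso X Z).hom (𝟙 Y) :=
  hom_ext <| tm_ext_right fun f x hx g y hy h z hz => by
    simp only [comp_lin, LinearMap.comp_apply, tensorMor_tm, assocIso_inv_tm hx hy hz, map_smul,
      braidIso_tm hx, braidIso_tm hy, braidIso_tm (tm_homog hx hy), hz.act_mul f g,
      assocIso_inv_tm hx (hz.act g) hy, assocIso_inv_tm ((hz.act g).act f) hx hy, smul_tm,
      smul_smul, id_lin, LinearMap.id_apply, ← Units.val_mul]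
    congr 2
    rw [Cocycle₃.slant]
    simp [mul_assoc]

instance : MonoidalCategoryStruct (Obj α) where
  tensorObj := tensor
  whiskerLeft X _ _ φ := tensorMor (𝟙 X) φ
  whiskerRight φ Y := tensorMor φ (𝟙 Y)
  tensorHom := tensorMor
  tensorUnit := one α
  associator := assocIso
  leftUnitor := lunitIso
  rightUnitor := runitIso

instance : MonoidalCategory (Obj α) := MonoidalCategory.ofTensorHom
  (id_tensorHom_id := fun X Y => hom_ext (tm_ext (X := X) (Y := Y) fun _ _ _ _ _ _ => rfl))
  (id_tensorHom := fun _ _ _ _ => rfl)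
  (tensorHom_id := fun _ _ => rfl)
  (tensorHom_comp_tensorHom := fun {X₁ _ _ X₂ _ _} _ _ _ _ =>
    hom_ext (tm_ext (X := X₁) (Y := X₂) fun _ _ _ _ _ _ => rfl))
  (associator_naturality := assoc_natural)
  (leftUnitor_naturality := fun {X _} φ => hom_ext <| tm_ext (X := one α) (Y := X)
    fun _ c _ _ x _ => (map_smul (Hom.lin φ) (show k from c) x).symm)
  (rightUnitor_naturality := fun {X _} φ => hom_ext <| tm_ext (X := X) (Y := one α)
    fun _ x _ _ c _ => (map_smul (Hom.lin φ) (show k from c) x).symm)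
  (pentagon := assoc_pentagon)
  (triangle := unit_triangle)

instance : BraidedCategory (Obj α) where
  braiding := braidIso
  braiding_naturality_right X _ _ φ := braid_natural (𝟙 X) φ
  braiding_naturality_left φ Z := braid_natural φ (𝟙 Z)
  hexagon_forward := braid_hexagon_forward
  hexagon_reverse := braid_hexagon_reverse

end Monoidal

end Obj

/-! ### Modules, local modules and Lagrangian algebras -/

section Lagrangian

open MonObj

variable {C : Type*} [Category C] [MonoidalCategory C]

/-- A right module over an algebra `A` in a monoidal category. -/
structure RightMod (A : C) [MonObj A] where
  X : C
  act : X ⊗ A ⟶ X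
  act_one : X ◁ η[A] ≫ act = (ρ_ X).hom
  act_act : act ▷ A ≫ act = (α_ X A A).hom ≫ X ◁ μ[A] ≫ act

namespace RightMod

variable (A : C) [MonObj A]

/-- The regular right module. -/
def regular : RightMod A where
  X := A
  act := μ[A]
  act_one := mul_one A
  act_act := mul_assoc A

variable {A}

/-- Homomorphisms of right modules. -/
def IsModHom (M N : RightMod A) (φ : M.X ⟶ N.X) : Prop :=
  M.act ≫ φ = φ ▷ A ≫ N.act

/-- A right module is local if its action is unchanged by the double braiding. -/
def IsLocal [BraidedCategory C] (M : RightMod A) : Prop :=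
  (β_ M.X A).hom ≫ (β_ A M.X).hom ≫ M.act = M.act

/-- The module `M` is a (finite) direct sum of copies of the regular module. -/
def IsSumOfRegular [Preadditive C] (M : RightMod A) : Prop :=
  ∃ (n : ℕ) (i : Fin n → ((regular A).X ⟶ M.X)) (p : Fin n → (M.X ⟶ (regular A).X)),
    (∀ a, IsModHom (regular A) M (i a)) ∧ (∀ a, IsModHom M (regular A) (p a)) ∧
    (∀ a, i a ≫ p a = 𝟙 _) ∧ (∀ a b, a ≠ b → i a ≫ p b = 0) ∧ ∑ a, p a ≫ i a = 𝟙 M.X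

end RightMod

/-- A Lagrangian algebra: a nonzero commutative algebra such that every local module over it is a
direct sum of copies of the regular module. (Over the zero algebra every module is zero, so that
the condition on local modules would hold there for an empty reason.) -/
structure IsLagrangian [BraidedCategory C] [Preadditive C] (A : C) [MonObj A] : Prop where
  comm : IsCommMonObj A
  nonzero : ¬ Limits.IsZero A
  free : ∀ M : RightMod A, M.IsLocal → M.IsSumOfRegular

end Lagrangian

/-! ### The transfer functor `E` -/

namespace Obj

section Transfer


variable {α : Cocycle₃ G k} {H : Subgroup G} [Fintype H]

/-- The grading of an `H`-graded space, viewed as a `G`-grading with support in `H`. -/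
def extProj (V : Obj (α.restrict H)) (g : G) : Module.End k V :=
  open scoped Classical in if hg : g ∈ H then V.proj ⟨g, hg⟩ else 0

lemma extProj_coe (V : Obj (α.restrict H)) (h : H) : V.extProj (h : G) = V.proj h := by
  simp [extProj]

lemma extProj_of_notMem (V : Obj (α.restrict H)) {g : G} (hg : g ∉ H) : V.extProj g = 0 := by
  simp [extProj, hg]

lemma extProj_grading (V : Obj (α.restrict H)) : CompleteOrthogonalIdempotents V.extProj := by
  classical
  rw [CompleteOrthogonalIdempotents.iff_ortho_complete]
  constructor
  · intro g g' hgg'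
    by_cases hg : g ∈ H
    · by_cases hg' : g' ∈ H
      · change V.extProj g * V.extProj g' = 0
        rw [extProj, extProj, dif_pos hg, dif_pos hg']
        exact V.grading.ortho (by simpa using hgg')
      · simp [V.extProj_of_notMem hg']
    · simp [V.extProj_of_notMem hg]
  · rw [← V.grading.complete, ← Finset.sum_subset (Finset.subset_univ
      (Finset.univ.map (Function.Embedding.subtype (· ∈ H)))), Finset.sum_map]
    · exact Finset.sum_congr rfl fun h _ => V.extProj_coe h
    · intro g _ hg
      apply V.extProj_of_notMem
      simpa using hg

/-- `v` is homogeneous of degree `g ∈ G`. -/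
abbrev ExtHomog (V : Obj (α.restrict H)) (g : G) (v : V) : Prop := IsHomog V.extProj g v

lemma ExtHomog.cases {V : Obj (α.restrict H)} {g : G} {v : V} (hv : V.ExtHomog g v) :
    v = 0 ∨ ∃ h : H, (h : G) = g ∧ V.Homog h v := by
  by_cases hg : g ∈ H
  · refine Or.inr ⟨⟨g, hg⟩, rfl, ?_⟩
    rw [Homog, IsHomog, ← V.extProj_coe]
    exact hv
  · left
    rw [← hv, V.extProj_of_notMem hg, LinearMap.zero_apply]

lemma Homog.ext {V : Obj (α.restrict H)} {h : H} {v : V} (hv : V.Homog h v) :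
    V.ExtHomog h v := by
  rw [ExtHomog, IsHomog, V.extProj_coe, hv]

lemma ExtHomog.act {V : Obj (α.restrict H)} {g : G} {v : V} (hv : V.ExtHomog g v) (h : H) :
    V.ExtHomog (h * g * h⁻¹) (V.act h v) := by
  obtain rfl | ⟨g, rfl, hv'⟩ := hv.cases
  · rw [map_zero]
    exact IsHomog.zero _ _
  · exact Homog.ext (IsHomog.act hv' h)

lemma ExtHomog.act_mul {V : Obj (α.restrict H)} {g : G} {v : V} (hv : V.ExtHomog g v)
    (h h' : H) :
    V.act (h * h') v = (α.slant h h' g : k) • V.act h (V.act h' v) := by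
  obtain rfl | ⟨g, rfl, hv'⟩ := hv.cases
  · simp
  · exact IsHomog.act_mul hv' h h'

/-- The grading on `Map(G, V)`: `|a| = f` iff `|a(x)| = x⁻¹ f x` for all `x`. -/
def mapProj (V : Obj (α.restrict H)) (f : G) : Module.End k (G → V) :=
  LinearMap.pi fun x => V.extProj (x⁻¹ * f * x) ∘ₗ LinearMap.proj x

@[simp] lemma mapProj_apply (V : Obj (α.restrict H)) (f : G) (a : G → V) (x : G) :
    V.mapProj f a x = V.extProj (x⁻¹ * f * x) (a x) := rfl

lemma mapHomog_iff {V : Obj (α.restrict H)} {f : G} {a : G → V} :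
    IsHomog V.mapProj f a ↔ ∀ x, V.ExtHomog (x⁻¹ * f * x) (a x) :=
  funext_iff

lemma mapProj_grading (V : Obj (α.restrict H)) : CompleteOrthogonalIdempotents V.mapProj := by
  rw [CompleteOrthogonalIdempotents.iff_ortho_complete]
  constructor
  · intro f g hfg
    ext a x
    exact LinearMap.congr_fun (V.extProj_grading.ortho (i := x⁻¹ * f * x) (j := x⁻¹ * g * x)
      (by simpa using hfg)) (a x)
  · refine LinearMap.ext fun a => funext fun x => ?_
    simp only [LinearMap.sum_apply, Finset.sum_apply, mapProj_apply, Module.End.one_apply]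
    refine Eq.trans ?_ (sum_proj V.extProj_grading (a x))
    exact Fintype.sum_equiv (MulAut.conj x⁻¹).toEquiv _ (fun g => V.extProj g (a x))
      (fun g => by simp)

/-- The `α`-projective action of `G` on `Map(G, V)`:
`(g.a)(x) = α(x⁻¹,g|f)⁻¹ a(g⁻¹x)` for `|a| = f`. -/
def mapAct (V : Obj (α.restrict H)) (g : G) : Module.End k (G → V) :=
  LinearMap.pi fun x => ∑ f, ((α.slant x⁻¹ g f)⁻¹ : kˣ).val •
    (LinearMap.proj (g⁻¹ * x) ∘ₗ V.mapProj f)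

lemma mapAct_apply {V : Obj (α.restrict H)} {f : G} {a : G → V} (ha : IsHomog V.mapProj f a)
    (g x : G) : V.mapAct g a x = ((α.slant x⁻¹ g f)⁻¹ : kˣ).val • a (g⁻¹ * x) := by
  classical
  simp only [mapAct, LinearMap.pi_apply, LinearMap.sum_apply, LinearMap.smul_apply,
    LinearMap.comp_apply, LinearMap.proj_apply, ha.proj_eq V.mapProj_grading]
  rw [Finset.sum_eq_single f] <;> simp +contextual

lemma mapHomog_act {V : Obj (α.restrict H)} {f : G} {a : G → V} (ha : IsHomog V.mapProj f a)
    (g : G) : IsHomog V.mapProj (g * f * g⁻¹) (V.mapAct g a) := by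
  rw [mapHomog_iff]
  intro x
  rw [mapAct_apply ha]
  have := (mapHomog_iff.1 ha (g⁻¹ * x)).smul ((α.slant x⁻¹ g f)⁻¹ : kˣ).val
  simpa [mul_assoc] using this

/-- The subspace `E(V)` of `Map(G, V)`, spanned by the homogeneous `a` with
`a(xh) = α(h⁻¹,x⁻¹|f) h⁻¹.a(x)` for `h ∈ H`, `x ∈ G`, where `|a| = f`. -/
def transferSubmodule (V : Obj (α.restrict H)) : Submodule k (G → V) where
  carrier := {a | ∀ (f x : G) (h : H), V.mapProj f a (x * h) =
    (α.slant (h : G)⁻¹ x⁻¹ f : k) • V.act h⁻¹ (V.mapProj f a x)}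
  zero_mem' f x h := by simp
  add_mem' ha hb f x h := by simp only [map_add, Pi.add_apply, ha f x h, hb f x h, smul_add]
  smul_mem' c a ha f x h := by
    simp only [map_smul, Pi.smul_apply, ha f x h]
    rw [smul_comm]

lemma mem_transfer_iff {V : Obj (α.restrict H)} {f : G} {a : G → V}
    (ha : IsHomog V.mapProj f a) : a ∈ V.transferSubmodule ↔
      ∀ (x : G) (h : H), a (x * h) = (α.slant (h : G)⁻¹ x⁻¹ f : k) • V.act h⁻¹ (a x) := by
  classical
  constructor
  · intro h x y
    have := h f x y
    rwa [ha] at this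
  · intro h g x y
    rw [ha.proj_eq V.mapProj_grading]
    split_ifs with e
    · rw [e, h]
    · simp

lemma proj_mem_transfer {V : Obj (α.restrict H)} {a : G → V} (ha : a ∈ V.transferSubmodule)
    (f : G) : V.mapProj f a ∈ V.transferSubmodule :=
  (mem_transfer_iff (isHomog_proj V.mapProj_grading f a)).2 (ha f)

lemma act_mem_transfer {V : Obj (α.restrict H)} {a : G → V} (ha : a ∈ V.transferSubmodule)
    (g : G) : V.mapAct g a ∈ V.transferSubmodule := by
  rw [← sum_proj V.mapProj_grading a, map_sum]
  refine Submodule.sum_mem _ fun f _ => ?_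
  have hb := proj_mem_transfer ha f
  have hf := isHomog_proj V.mapProj_grading f a
  generalize V.mapProj f a = b at hb hf
  rw [mem_transfer_iff hf] at hb
  rw [mem_transfer_iff (mapHomog_act hf g)]
  intro x h
  rw [mapAct_apply hf, mapAct_apply hf, ← mul_assoc, hb, map_smul, smul_smul, smul_smul,
    ← Units.val_mul, ← Units.val_mul]
  congr 2
  have := α.slant_slant (h : G)⁻¹ x⁻¹ g f
  rw [inv_mul_eq_iff_eq_mul, mul_inv_rev, mul_inv_rev, inv_inv, ← mul_assoc, ← this,
    mul_inv_cancel_right]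

/-- The object `E(V)` of `𝒵(G, α)` for an object `V` of `𝒵(H, α|_H)`. -/
def transfer (V : Obj (α.restrict H)) : Obj α where
  carrier := V.transferSubmodule
  proj f := (V.mapProj f).restrict fun _ ha => proj_mem_transfer ha f
  grading := by
    rw [CompleteOrthogonalIdempotents.iff_ortho_complete]
    constructor
    · intro f g hfg
      ext1 a
      exact Subtype.ext (LinearMap.congr_fun (V.mapProj_grading.ortho hfg) a.1)
    · ext1 a
      apply Subtype.ext
      simp only [LinearMap.sum_apply, Module.End.one_apply, Submodule.coe_sum,
        LinearMap.coe_restrict_apply]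
      exact sum_proj V.mapProj_grading a.1
  act g := (V.mapAct g).restrict fun _ ha => act_mem_transfer ha g
  act_one := by
    ext1 a
    apply Subtype.ext
    simp only [LinearMap.coe_restrict_apply]
    refine LinearMap.congr_fun (f := V.mapAct 1) (g := 1) (hext V.mapProj_grading ?_) a.1
    intro f b hb
    funext x
    simp [mapAct_apply hb]
  act_proj f g a := Subtype.ext <| comm_proj V.mapProj_grading V.mapProj_grading
    (V.mapAct f) (fun g => f * g * f⁻¹) (MulAut.conj f).injective
    (fun _ _ hb => mapHomog_act hb f) g a.1
  act_mul f g h a := Subtype.ext <| by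
    have hb := isHomog_proj V.mapProj_grading h a.1
    funext x
    change V.mapAct (f * g) (V.mapProj h a.1) x =
      (α.slant f g h : k) • V.mapAct f (V.mapAct g (V.mapProj h a.1)) x
    generalize V.mapProj h a.1 = b at hb
    rw [mapAct_apply hb, mapAct_apply (mapHomog_act hb g), mapAct_apply hb]
    simp only [smul_smul, ← Units.val_mul, mul_inv_rev, inv_inv, mul_assoc]
    congr 2
    have := α.slant_slant x⁻¹ f g h
    rw [inv_eq_iff_mul_eq_one]
    simp only [mul_assoc] at this ⊢
    rw [← mul_assoc, this]
    group

/-! The transfer of an algebra is an algebra. -/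

open MonObj

/-- The product of two elements of an algebra in `𝒵(G, α)`. -/
def mulBil (B : Obj α) [MonObj B] : B →ₗ[k] B →ₗ[k] B :=
  TensorProduct.curry (show B ⊗[k] B →ₗ[k] B from Hom.lin μ[B])

/-- The unit element of an algebra in `𝒵(G, α)`. -/
def unitElt (B : Obj α) [MonObj B] : B := Hom.lin η[B] (1 : k)

section

variable {B : Obj α} [MonObj B]

lemma unitElt_homog : B.Homog 1 B.unitElt := map_homog η[B] (one_homog _)

lemma act_unitElt (f : G) : B.act f B.unitElt = B.unitElt :=
  (Hom.map_act η[B] f (1 : k)).symm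

lemma unitElt_mul (b : B) : B.mulBil B.unitElt b = b := by
  have h := LinearMap.congr_fun (congrArg Hom.lin (one_mul B)) (tm (X := one α) (1 : k) b)
  exact h.trans (one_smul k b)

lemma mul_unitElt (b : B) : B.mulBil b B.unitElt = b := by
  have h := LinearMap.congr_fun (congrArg Hom.lin (mul_one B)) (tm (Y := one α) b (1 : k))
  exact h.trans (one_smul k b)

lemma mulBil_homog {f g : G} {a b : B} (ha : B.Homog f a) (hb : B.Homog g b) :
    B.Homog (f * g) (B.mulBil a b) := map_homog μ[B] (tm_homog ha hb)

lemma act_mulBil {g h : G} {a b : B} (ha : B.Homog g a) (hb : B.Homog h b) (f : G) :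
    B.act f (B.mulBil a b) = (α.coslant f g h : k) • B.mulBil (B.act f a) (B.act f b) := by
  have h1 := Hom.map_act μ[B] f (tm a b)
  refine h1.symm.trans ((congrArg _ (act_tm ha hb f)).trans ?_)
  exact map_smul (Hom.lin μ[B]) _ _

lemma mulBil_assoc {f g h : G} {a b c : B} (ha : B.Homog f a) (hb : B.Homog g b)
    (hc : B.Homog h c) :
    B.mulBil a (B.mulBil b c) = (α f g h : k) • B.mulBil (B.mulBil a b) c := by
  have h1 := LinearMap.congr_fun (congrArg Hom.lin (mul_assoc B)) (tm (tm a b) c)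
  have h2 : B.mulBil (B.mulBil a b) c = ((α f g h)⁻¹ : kˣ).val • B.mulBil a (B.mulBil b c) := by
    refine h1.trans ?_
    change Hom.lin μ[B] (Hom.lin (B ◁ μ[B]) (assocLin B B B (tm (tm a b) c))) = _
    rw [assocLin_tm ha hb hc]
    refine (congrArg (Hom.lin μ[B]) (map_smul (Hom.lin (B ◁ μ[B])) _ _)).trans ?_
    exact map_smul (Hom.lin μ[B]) _ _
  rw [h2, smul_smul, Units.mul_inv, one_smul]

end

/-- An algebra in `𝒵(G, α)` from a graded `α`-associative product and a unit. -/
@[reducible] def mkMonObj (A : Obj α) (m : A →ₗ[k] A →ₗ[k] A) (e : A) (he : A.Homog 1 e)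
    (hact : ∀ f, A.act f e = e) (h_one : ∀ a, m e a = a) (h_one' : ∀ a, m a e = a)
    (h_deg : ∀ f g a b, A.Homog f a → A.Homog g b → A.Homog (f * g) (m a b))
    (h_act : ∀ f g h a b, A.Homog g a → A.Homog h b →
      (α.coslant f g h : k) • m (A.act f a) (A.act f b) = A.act f (m a b))
    (h_assoc : ∀ f g h a b c, A.Homog f a → A.Homog g b → A.Homog h c →
      m a (m b c) = (α f g h : k) • m (m a b) c) : MonObj A where
  one := mkHom (X := one α) (Y := A) (LinearMap.toSpanSingleton k A e)
    (fun g c hc => by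
      obtain rfl | rfl := eq_one_or_eq_zero hc
      · exact he.smul c
      · change A.Homog g ((0 : k) • e)
        rw [zero_smul]
        exact IsHomog.zero A.proj g)
    (fun f g c hc => by
      change (show k from c) • e = A.act f ((show k from c) • e)
      rw [map_smul, hact])
  mul := mkHom₂ (TensorProduct.lift m)
    (fun g x hx h y hy => h_deg g h x y hx hy)
    (fun f g x hx h y hy => h_act f g h x y hx hy)
  one_mul := hom_ext <| tm_ext (X := one α) (Y := A) fun _ c _ _ a _ => by
    change m ((show k from c) • e) a = (show k from c) • a
    rw [map_smul, LinearMap.smul_apply, h_one]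
  mul_one := hom_ext <| tm_ext (X := A) (Y := one α) fun _ a _ _ c _ => by
    change m a ((show k from c) • e) = (show k from c) • a
    rw [map_smul, h_one']
  mul_assoc := hom_ext <| tm_ext_left (X := A) (Y := A) (Z := A) fun f a ha g b hb h c hc => by
    let M : tensor A A ⟶ A := mkHom₂ (TensorProduct.lift m)
      (fun g x hx h y hy => h_deg g h x y hx hy) (fun f g x hx h y hy => h_act f g h x y hx hy)
    change m (m a b) c = Hom.lin M (Hom.lin (tensorMor (𝟙 A) M) (assocLin A A A (tm (tm a b) c)))
    rw [assocLin_tm ha hb hc, map_smul, map_smul]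
    change _ = _ • m a (m b c)
    rw [h_assoc f g h a b c ha hb hc, smul_smul, Units.inv_mul, one_smul]

section

variable (B : Obj (α.restrict H)) [MonObj B]

lemma ext_unitElt : B.ExtHomog 1 B.unitElt := Homog.ext (h := 1) unitElt_homog

variable {B}

lemma ext_mul {f g : G} {a b : B} (ha : B.ExtHomog f a) (hb : B.ExtHomog g b) :
    B.ExtHomog (f * g) (B.mulBil a b) := by
  obtain rfl | ⟨f, rfl, ha'⟩ := ha.cases
  · simpa using IsHomog.zero _ _
  obtain rfl | ⟨g, rfl, hb'⟩ := hb.cases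
  · simpa using IsHomog.zero _ _
  exact Homog.ext (h := f * g) (mulBil_homog ha' hb')

lemma ext_act_mul {f g : G} {a b : B} (ha : B.ExtHomog f a) (hb : B.ExtHomog g b) (h : H) :
    B.act h (B.mulBil a b) = (α.coslant h f g : k) • B.mulBil (B.act h a) (B.act h b) := by
  obtain rfl | ⟨f, rfl, ha'⟩ := ha.cases
  · simp
  obtain rfl | ⟨g, rfl, hb'⟩ := hb.cases
  · simp
  exact act_mulBil ha' hb' h

lemma ext_mul_assoc {f g h : G} {a b c : B} (ha : B.ExtHomog f a) (hb : B.ExtHomog g b)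
    (hc : B.ExtHomog h c) :
    B.mulBil a (B.mulBil b c) = (α f g h : k) • B.mulBil (B.mulBil a b) c := by
  obtain rfl | ⟨f, rfl, ha'⟩ := ha.cases
  · simp
  obtain rfl | ⟨g, rfl, hb'⟩ := hb.cases
  · simp
  obtain rfl | ⟨h, rfl, hc'⟩ := hc.cases
  · simp
  exact mulBil_assoc ha' hb' hc'

variable (B)

/-- The product `(ab)(x) = α(x⁻¹|f,g) a(x) b(x)` on `Map(G, B)`, for `|a| = f` and `|b| = g`. -/
def mapMul : (G → B) →ₗ[k] (G → B) →ₗ[k] (G → B) :=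
  LinearMap.mk₂ k (fun a b x => ∑ f, ∑ g, (α.coslant x⁻¹ f g : k) •
      B.mulBil (B.mapProj f a x) (B.mapProj g b x))
    (fun a a' b => by
      funext x
      simp only [map_add, Pi.add_apply, LinearMap.add_apply, smul_add, Finset.sum_add_distrib])
    (fun c a b => by
      funext x
      simp only [map_smul, Pi.smul_apply, LinearMap.smul_apply, Finset.smul_sum, smul_comm c])
    (fun a b b' => by
      funext x
      simp only [map_add, Pi.add_apply, smul_add, Finset.sum_add_distrib])
    (fun c a b => by
      funext x
      simp only [map_smul, Pi.smul_apply, Finset.smul_sum, smul_comm c])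

variable {B}

lemma mapMul_apply {f g : G} {a b : G → B} (ha : IsHomog B.mapProj f a)
    (hb : IsHomog B.mapProj g b) (x : G) :
    B.mapMul a b x = (α.coslant x⁻¹ f g : k) • B.mulBil (a x) (b x) := by
  classical
  simp only [mapMul, LinearMap.mk₂_apply, ha.proj_eq B.mapProj_grading,
    hb.proj_eq B.mapProj_grading]
  rw [Finset.sum_eq_single f, Finset.sum_eq_single g] <;> simp +contextual

lemma mapMul_homog {f g : G} {a b : G → B} (ha : IsHomog B.mapProj f a)
    (hb : IsHomog B.mapProj g b) : IsHomog B.mapProj (f * g) (B.mapMul a b) := by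
  rw [mapHomog_iff] at *
  intro x
  rw [mapMul_apply (mapHomog_iff.2 ha) (mapHomog_iff.2 hb)]
  have := (ext_mul (ha x) (hb x)).smul (α.coslant x⁻¹ f g : k)
  simpa [_root_.mul_assoc] using this

lemma mapMul_mem {a b : G → B} (ha : a ∈ B.transferSubmodule) (hb : b ∈ B.transferSubmodule) :
    B.mapMul a b ∈ B.transferSubmodule := by
  rw [← sum_proj B.mapProj_grading a, ← sum_proj B.mapProj_grading b, map_sum]
  refine Submodule.sum_mem _ fun g _ => ?_
  rw [map_sum, LinearMap.sum_apply]
  refine Submodule.sum_mem _ fun f _ => ?_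
  have ha' := proj_mem_transfer ha f
  have hb' := proj_mem_transfer hb g
  have hf := isHomog_proj B.mapProj_grading f a
  have hg := isHomog_proj B.mapProj_grading g b
  generalize B.mapProj f a = a' at ha' hf
  generalize B.mapProj g b = b' at hb' hg
  rw [mem_transfer_iff hf] at ha'
  rw [mem_transfer_iff hg] at hb'
  rw [mem_transfer_iff (mapMul_homog hf hg)]
  intro x h
  rw [mapMul_apply hf hg, mapMul_apply hf hg, ha', hb', map_smul, map_smul,
    LinearMap.smul_apply, map_smul,
    ext_act_mul (mapHomog_iff.1 hf x) (mapHomog_iff.1 hg x)]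
  simp only [smul_smul, ← Units.val_mul]
  congr 2
  have := α.coslant_slant (h : G)⁻¹ x⁻¹ f g
  simp only [inv_inv, mul_inv_rev, InvMemClass.coe_inv] at this ⊢
  rw [← _root_.mul_assoc, ← _root_.mul_assoc, ← this]
  ac_rfl

lemma const_homog {b : B} (hb : B.ExtHomog 1 b) :
    IsHomog B.mapProj 1 (fun _ : G => b) := by
  rw [mapHomog_iff]
  intro x
  simpa using hb

variable (B) in
/-- The unit of `E(B)` is the constant map with value the unit of `B`. -/
lemma const_mem : (fun _ : G => B.unitElt) ∈ B.transferSubmodule := by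
  rw [mem_transfer_iff (const_homog B.ext_unitElt)]
  intro x h
  simp [act_unitElt]

lemma transfer_homog_iff {f : G} {a : B.transfer} :
    B.transfer.Homog f a ↔ IsHomog B.mapProj f a.1 :=
  Subtype.ext_iff

variable (B) in
/-- The product on `E(B)`. -/
def transferMul : B.transfer →ₗ[k] B.transfer →ₗ[k] B.transfer :=
  LinearMap.mk₂ k (fun a b => ⟨B.mapMul a.1 b.1, mapMul_mem a.2 b.2⟩)
    (fun a a' b => Subtype.ext (LinearMap.map_add₂ B.mapMul a.1 a'.1 b.1))
    (fun c a b => Subtype.ext (LinearMap.map_smul₂ B.mapMul c a.1 b.1))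
    (fun a b b' => Subtype.ext (map_add (B.mapMul a.1) b.1 b'.1))
    (fun c a b => Subtype.ext (map_smul (B.mapMul a.1) c b.1))

/-- The algebra structure on `E(B)` for an algebra `B` in `𝒵(H, α|_H)`. -/
instance transferMonObj : MonObj B.transfer :=
  mkMonObj B.transfer B.transferMul ⟨fun _ => B.unitElt, B.const_mem⟩
    (transfer_homog_iff.2 (const_homog B.ext_unitElt))
    (fun f => Subtype.ext <| funext fun x => by
      change B.mapAct f (fun _ => B.unitElt) x = B.unitElt
      rw [mapAct_apply (const_homog B.ext_unitElt)]
      simp)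
    (fun a => Subtype.ext <| by
      refine LinearMap.congr_fun (f := B.mapMul fun _ => B.unitElt) (g := LinearMap.id)
        (hext B.mapProj_grading fun f b hb => funext fun x => ?_) a.1
      rw [mapMul_apply (const_homog B.ext_unitElt) hb]
      simp [unitElt_mul])
    (fun a => Subtype.ext <| by
      refine LinearMap.congr_fun (f := B.mapMul.flip fun _ => B.unitElt) (g := LinearMap.id)
        (hext B.mapProj_grading fun f b hb => funext fun x => ?_) a.1
      rw [LinearMap.flip_apply, mapMul_apply hb (const_homog B.ext_unitElt)]
      simp [mul_unitElt])
    (fun f g a b ha hb => by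
      rw [transfer_homog_iff] at *
      exact mapMul_homog ha hb)
    (fun f g h a b ha hb => Subtype.ext <| funext fun x => by
      rw [transfer_homog_iff] at ha hb
      change (α.coslant f g h : k) • B.mapMul (B.mapAct f a.1) (B.mapAct f b.1) x =
        B.mapAct f (B.mapMul a.1 b.1) x
      rw [mapMul_apply (mapHomog_act ha f) (mapHomog_act hb f), mapAct_apply ha,
        mapAct_apply hb, mapAct_apply (mapMul_homog ha hb), mapMul_apply ha hb]
      simp only [map_smul, LinearMap.smul_apply, smul_smul, ← Units.val_mul]
      congr 2
      have h1 := congrArg Additive.ofMul (α.coslant_slant x⁻¹ f g h)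
      apply Additive.ofMul.injective
      simp only [ofMul_mul, ofMul_inv, mul_inv_rev, inv_inv] at h1 ⊢
      linear_combination (norm := abel) -h1)
    (fun f g h a b c ha hb hc => Subtype.ext <| funext fun x => by
      rw [transfer_homog_iff] at ha hb hc
      change B.mapMul a.1 (B.mapMul b.1 c.1) x =
        (α f g h : k) • B.mapMul (B.mapMul a.1 b.1) c.1 x
      rw [mapMul_apply ha (mapMul_homog hb hc), mapMul_apply hb hc,
        mapMul_apply (mapMul_homog ha hb) hc, mapMul_apply ha hb, map_smul,
        ext_mul_assoc (mapHomog_iff.1 ha x) (mapHomog_iff.1 hb x) (mapHomog_iff.1 hc x)]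
      simp only [map_smul, LinearMap.smul_apply, smul_smul, ← Units.val_mul]
      congr 2
      have h1 := congrArg Additive.ofMul (α.coslant_coslant x⁻¹ f g h)
      apply Additive.ofMul.injective
      simp only [ofMul_mul, inv_inv] at h1 ⊢
      linear_combination (norm := abel) -h1)

end

end Transfer

end Obj

/-! ### Twisted group algebras and the algebras `L(H, γ)` -/

/-- Normalised 2-cochains of `G` with values in the multiplicative group of `k`. -/
structure Cochain₂ (G k : Type u) [Group G] [Field k] where
  toFun : G → G → kˣ
  one_left : ∀ g, toFun 1 g = 1
  one_right : ∀ g, toFun g 1 = 1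

namespace Cochain₂

section

variable {G k : Type u} [Group G] [Field k]

instance : CoeFun (Cochain₂ G k) (fun _ => G → G → kˣ) := ⟨Cochain₂.toFun⟩

/-- The differential `(dγ)(f,g,h) = γ(g,h) γ(fg,h)⁻¹ γ(f,gh) γ(f,g)⁻¹`. -/
def d (γ : Cochain₂ G k) (f g h : G) : kˣ :=
  γ g h * (γ (f * g) h)⁻¹ * γ f (g * h) * (γ f g)⁻¹

/-- `ε_f(g) = γ(f,g) / γ(fgf⁻¹,f)`. -/
def eps (γ : Cochain₂ G k) (f g : G) : kˣ := γ f g / γ (f * g * f⁻¹) f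

variable {γ : Cochain₂ G k} {α : Cocycle₃ G k}

lemma d_mul (hγ : γ.d = α) (f g h : G) :
    γ g h * γ f (g * h) = α f g h * (γ f g * γ (f * g) h) := by
  have : α f g h = γ.d f g h := (congrFun (congrFun (congrFun hγ f) g) h).symm
  rw [this, d]
  apply Additive.ofMul.injective
  simp only [ofMul_mul, ofMul_inv]
  abel

lemma eps_mul (hγ : γ.d = α) (f g h : G) :
    γ.eps (f * g) h = α.slant f g h * (γ.eps g h * γ.eps f (g * h * g⁻¹)) := by
  have h1 := congrArg Additive.ofMul (d_mul hγ f g h)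
  have h2 := congrArg Additive.ofMul (d_mul hγ f (g * h * g⁻¹) g)
  have h3 := congrArg Additive.ofMul (d_mul hγ (f * g * h * (f * g)⁻¹) f g)
  apply Additive.ofMul.injective
  simp only [eps, Cocycle₃.slant, ofMul_mul, ofMul_inv, ofMul_div, mul_assoc, mul_inv_rev,
    inv_mul_cancel, mul_one] at *
  linear_combination (norm := abel) h2 - h1 - h3

lemma mul_eps (hγ : γ.d = α) (f g h : G) :
    γ g h * γ.eps f (g * h) =
      α.coslant f g h * (γ.eps f g * γ.eps f h * γ (f * g * f⁻¹) (f * h * f⁻¹)) := by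
  have h1 := congrArg Additive.ofMul (d_mul hγ f g h)
  have h2 := congrArg Additive.ofMul (d_mul hγ (f * g * f⁻¹) f h)
  have h3 := congrArg Additive.ofMul (d_mul hγ (f * g * f⁻¹) (f * h * f⁻¹) f)
  apply Additive.ofMul.injective
  simp only [eps, Cocycle₃.coslant, ofMul_mul, ofMul_inv, ofMul_div, mul_assoc,
    inv_mul_cancel, inv_mul_cancel_left, mul_one] at *
  linear_combination (norm := abel) h1 - h2 + h3

@[simp] lemma eps_one_left (g : G) : γ.eps 1 g = 1 := by
  simp [eps, γ.one_left, γ.one_right]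

@[simp] lemma eps_one_right (g : G) : γ.eps g 1 = 1 := by
  simp [eps, γ.one_left, γ.one_right]

end

variable {α : Cocycle₃ G k} (γ : Cochain₂ G k)

/-- The projection onto the line spanned by `e_g`, in `k[G, γ]`. -/
def algProj (g : G) : Module.End k (G → k) :=
  open scoped Classical in LinearMap.single k (fun _ => k) g ∘ₗ LinearMap.proj g

/-- The basis vector `e_g` of `k[G, γ]`. -/
def e (g : G) : G → k := open scoped Classical in Pi.single g 1

lemma algProj_apply (g : G) (v : G → k) : algProj g v = v g • (e g : G → k) := by
  classical
  simp [algProj, e, ← Pi.single_smul]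

lemma algProj_grading : CompleteOrthogonalIdempotents (algProj : G → Module.End k (G → k)) := by
  classical
  rw [CompleteOrthogonalIdempotents.iff_ortho_complete]
  constructor
  · intro g h hgh
    refine LinearMap.ext fun v => ?_
    simp [algProj_apply, e, hgh]
  · refine LinearMap.ext fun v => ?_
    funext x
    simp [algProj_apply, e, Pi.single_apply]

lemma isHomog_e (g : G) : IsHomog algProj g (e g : G → k) := by
  rw [IsHomog, algProj_apply]
  simp [e]

lemma eq_smul_e {g : G} {v : G → k} (hv : IsHomog algProj g v) : v = v g • (e g : G → k) := by
  rw [← algProj_apply, hv]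

/-- The action `h.e_f = ε_h(f) e_{hfh⁻¹}`. -/
def algAct (h : G) : Module.End k (G → k) :=
  ∑ f, (γ.eps h f : k) • (LinearMap.toSpanSingleton k (G → k) (e (h * f * h⁻¹)) ∘ₗ
    LinearMap.proj f)

lemma algAct_e (h f : G) : γ.algAct h (e f) = (γ.eps h f : k) • (e (h * f * h⁻¹) : G → k) := by
  classical
  simp only [algAct, LinearMap.sum_apply, LinearMap.smul_apply, LinearMap.comp_apply,
    LinearMap.proj_apply, LinearMap.toSpanSingleton_apply]
  rw [Finset.sum_eq_single f]
  · simp [e]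
  · intro b _ hb
    simp [e, hb]
  · simp

/-- The product `e_f e_g = γ(f,g) e_{fg}`. -/
def algMul : (G → k) →ₗ[k] (G → k) →ₗ[k] (G → k) :=
  LinearMap.mk₂ k (fun v w => ∑ f, ∑ g, (γ f g * (v f * w g) : k) • (e (f * g) : G → k))
    (fun v v' w => by
      simp only [Pi.add_apply, add_mul, mul_add, add_smul, Finset.sum_add_distrib])
    (fun c v w => by
      simp only [Pi.smul_apply, smul_eq_mul, Finset.smul_sum, smul_smul]
      refine Finset.sum_congr rfl fun f _ => Finset.sum_congr rfl fun g _ => ?_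
      congr 1
      ring)
    (fun v w w' => by
      simp only [Pi.add_apply, mul_add, add_smul, Finset.sum_add_distrib])
    (fun c v w => by
      simp only [Pi.smul_apply, smul_eq_mul, Finset.smul_sum, smul_smul]
      refine Finset.sum_congr rfl fun f _ => Finset.sum_congr rfl fun g _ => ?_
      congr 1
      ring)

lemma algMul_e (f g : G) : γ.algMul (e f) (e g) = (γ f g : k) • (e (f * g) : G → k) := by
  classical
  simp only [algMul, LinearMap.mk₂_apply]
  rw [Finset.sum_eq_single f, Finset.sum_eq_single g]
  · simp [e]
  · intro b _ hb
    simp [e, hb]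
  · simp
  · intro b _ hb
    simp [e, hb]
  · simp

/-- The object `k[G, γ]` of `𝒵(G, α)`, where `dγ = α`. -/
def groupAlgebra (hγ : γ.d = α) : Obj α where
  carrier := G → k
  proj := algProj
  grading := algProj_grading
  act := γ.algAct
  act_one := hext algProj_grading fun g v hv => by
    rw [eq_smul_e hv, map_smul, algAct_e]
    simp
  act_proj f := comm_proj algProj_grading algProj_grading (γ.algAct f) (fun g => f * g * f⁻¹)
    (MulAut.conj f).injective fun g v hv => by
      rw [eq_smul_e hv, map_smul, algAct_e]
      exact ((isHomog_e _).smul _).smul _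
  act_mul f g h v := by
    rw [algProj_apply, map_smul, map_smul, map_smul, algAct_e, algAct_e, map_smul, algAct_e,
      smul_comm (α.slant f g h : k)]
    simp only [smul_smul, ← Units.val_mul, mul_assoc, mul_inv_rev]
    congr 3
    have := eps_mul hγ f g h
    simpa [mul_assoc] using this

/-- The algebra structure on `k[G, γ]`. -/
instance groupAlgebraMonObj (hγ : γ.d = α) : MonObj (γ.groupAlgebra hγ) :=
  Obj.mkMonObj (γ.groupAlgebra hγ) γ.algMul (e 1) (isHomog_e 1)
    (fun f => by
      change γ.algAct f (e 1) = e 1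
      rw [algAct_e]
      simp)
    (LinearMap.congr_fun (f := γ.algMul (e 1)) (g := LinearMap.id)
      (hext algProj_grading fun g v hv => by
        rw [eq_smul_e hv, map_smul, algMul_e]
        simp [γ.one_left]))
    (LinearMap.congr_fun (f := γ.algMul.flip (e 1)) (g := LinearMap.id)
      (hext algProj_grading fun g v hv => by
        rw [eq_smul_e hv, map_smul, LinearMap.flip_apply, algMul_e]
        simp [γ.one_right]))
    (fun f g a b ha hb => by
      change IsHomog algProj (f * g) (γ.algMul a b)
      rw [eq_smul_e ha, eq_smul_e hb, map_smul, LinearMap.map_smul₂, algMul_e]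
      exact (((isHomog_e _).smul _).smul _).smul _)
    (fun f g h a b ha hb => by
      change (α.coslant f g h : k) • γ.algMul (γ.algAct f a) (γ.algAct f b) =
        γ.algAct f (γ.algMul a b)
      rw [eq_smul_e ha, eq_smul_e hb]
      simp only [map_smul, LinearMap.smul_apply, algMul_e, algAct_e, smul_smul]
      have h1 := congrArg Units.val (mul_eps hγ f g h)
      simp only [Units.val_mul] at h1
      have h2 : f * g * f⁻¹ * (f * h * f⁻¹) = f * (g * h) * f⁻¹ := by group
      rw [h2]
      congr 1
      linear_combination -(a g * b h) * h1)
    (fun f g h a b c ha hb hc => by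
      change γ.algMul a (γ.algMul b c) = (α f g h : k) • γ.algMul (γ.algMul a b) c
      rw [eq_smul_e ha, eq_smul_e hb, eq_smul_e hc]
      simp only [map_smul, LinearMap.smul_apply, algMul_e, smul_smul]
      have h1 := congrArg Units.val (d_mul hγ f g h)
      simp only [Units.val_mul] at h1
      rw [← mul_assoc f g h]
      congr 1
      linear_combination (a f * b g * c h) * h1)

end Cochain₂

/-- The algebra `L(H, γ) = E(k[H, γ])` in `𝒵(G, α)`, for a subgroup `H` of `G` and
`γ ∈ C²(H, kˣ)` with `dγ = α|_H`. -/
def lagrangianAlgebra (α : Cocycle₃ G k) (H : Subgroup G) (γ : Cochain₂ H k)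
    (hγ : γ.d = α.restrict H) : Mon (Obj α) :=
  letI : Fintype H := Fintype.ofFinite H
  ⟨(γ.groupAlgebra hγ).transfer⟩

end TwistedCentre

end

/-!
Let `B` be a nonzero commutative algebra in `𝒵(G, α)`. Its component `B₁` of degree `1` is a
finite-dimensional commutative algebra in the ordinary sense, hence has a character `χ`.
Commutativity and associativity give `χ(ab) χ(cd) = α(g, g⁻¹, g) χ(bc) χ(ad)` for `a`, `c` of degree
`g⁻¹` and `b`, `d` of degree `g`, so the pairing `χ(ab)` has rank at most one in each degree. The
degrees `H` where it does not vanish form a subgroup, and modulo its radical `B` has a basis indexed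
by `H`, whose structure constants are a cochain `γ` with `dγ = α|_H`. This is an `H`-equivariant
homomorphism `B → k[H, γ]`, hence by Frobenius reciprocity a homomorphism `B → L(H, γ)`.

The target is commutative, and its only invariants of degree `1` are the multiples of the unit. When
`B` is Lagrangian, every homomorphism to a nonzero algebra of this kind is an isomorphism.
-/

noncomputable section

namespace TwistedCentre

open CategoryTheory MonoidalCategory TensorProduct

/-! ### Homomorphisms out of Lagrangian algebras -/

section Lagrangian

open MonObj

variable {C : Type*} [Category C] [MonoidalCategory C] {A B : C} [MonObj A] [MonObj B]

namespace RightMod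

/-- Restriction of scalars of right modules along a homomorphism of algebras. -/
def restrictScalars (φ : A ⟶ B) [IsMonHom φ] (M : RightMod B) : RightMod A where
  X := M.X
  act := M.X ◁ φ ≫ M.act
  act_one := by
    rw [← MonoidalCategory.whiskerLeft_comp_assoc, IsMonHom.one_hom, M.act_one]
  act_act := by
    rw [← MonoidalCategory.whiskerLeft_comp_assoc, IsMonHom.mul_hom,
      MonoidalCategory.tensorHom_def, comp_whiskerRight, Category.assoc,
      ← whisker_exchange_assoc, M.act_act]
    simp

variable [BraidedCategory C]

lemma IsLocal.restrictScalars (φ : A ⟶ B) [IsMonHom φ] {M : RightMod B} (hM : M.IsLocal) :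
    (M.restrictScalars φ).IsLocal := by
  change (β_ M.X A).hom ≫ (β_ A M.X).hom ≫ M.X ◁ φ ≫ M.act = M.X ◁ φ ≫ M.act
  rw [← BraidedCategory.braiding_naturality_left_assoc,
    ← BraidedCategory.braiding_naturality_right_assoc, hM]

lemma isLocal_regular [IsCommMonObj A] : (regular A).IsLocal := by
  change (β_ A A).hom ≫ (β_ A A).hom ≫ μ = μ
  rw [IsCommMonObj.mul_comm, IsCommMonObj.mul_comm]

end RightMod

/-- The endomorphism of an object given by an endomorphism of the unit object: in a `k`-linear
category with `End(𝟙) = k`, multiplication by a scalar. -/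
def scalar (s : 𝟙_ C ⟶ 𝟙_ C) (X : C) : X ⟶ X := (λ_ X).inv ≫ s ▷ X ≫ (λ_ X).hom

lemma scalar_naturality (s : 𝟙_ C ⟶ 𝟙_ C) {X Y : C} (f : X ⟶ Y) :
    scalar s X ≫ f = f ≫ scalar s Y := by
  rw [scalar, scalar, Category.assoc, Category.assoc, ← leftUnitor_naturality,
    ← whisker_exchange_assoc, leftUnitor_inv_naturality_assoc]

/-- An algebra `A` is haploid (or connected) if every morphism `𝟙 ⟶ A` is a multiple of the unit.
In a linear category with `End(𝟙) = k` this says `dim Hom(𝟙, A) ≤ 1`, so that the zero algebra is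
haploid. -/
def IsHaploid (A : C) [MonObj A] : Prop := ∀ f : 𝟙_ C ⟶ A, ∃ s : 𝟙_ C ⟶ 𝟙_ C, f = s ≫ η[A]

lemma IsHaploid.exists_eq_scalar_comp (hB : IsHaploid B) (φ : A ⟶ B) [IsMonHom φ] {ψ : A ⟶ B}
    (hψ : RightMod.IsModHom (.regular A) ((RightMod.regular B).restrictScalars φ) ψ) :
    ∃ s, ψ = scalar s A ≫ φ := by
  obtain ⟨s, hs⟩ := hB (η[A] ≫ ψ)
  have hψ' : μ[A] ≫ ψ = ψ ▷ A ≫ B ◁ φ ≫ μ[B] := hψ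
  refine ⟨s, ?_⟩
  calc ψ = (λ_ A).inv ≫ η[A] ▷ A ≫ μ[A] ≫ ψ := by simp
    _ = (λ_ A).inv ≫ (η[A] ≫ ψ) ▷ A ≫ B ◁ φ ≫ μ[B] := by
      rw [hψ', comp_whiskerRight_assoc]
    _ = (λ_ A).inv ≫ s ▷ A ≫ 𝟙_ C ◁ φ ≫ η[B] ▷ B ≫ μ[B] := by
      rw [hs, comp_whiskerRight_assoc, whisker_exchange_assoc]
    _ = scalar s A ≫ φ := by simp [scalar]

/-- As a local module over `A`, the algebra `B` is a sum of copies of `A`. Since `B` is haploid,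
each of these is embedded by a multiple of `φ`, and multiples of the projections invert `φ`. -/
theorem IsLagrangian.isIso [BraidedCategory C] [Preadditive C] [IsCommMonObj B]
    (hA : IsLagrangian A) (hB : IsHaploid B) (hB₀ : ¬ Limits.IsZero B) (φ : A ⟶ B) [IsMonHom φ] :
    IsIso φ := by
  obtain ⟨n, i, p, hi, hip, hpi⟩ : ∃ (n : ℕ) (i : Fin n → (A ⟶ B)) (p : Fin n → (B ⟶ A)),
      (∀ j, RightMod.IsModHom (.regular A) ((RightMod.regular B).restrictScalars φ) (i j)) ∧
      (∀ j, i j ≫ p j = 𝟙 A) ∧ ∑ j, p j ≫ i j = 𝟙 B := by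
    obtain ⟨n, i, p, hi, -, hip, -, hpi⟩ := hA.free _ (RightMod.isLocal_regular.restrictScalars φ)
    exact ⟨n, i, p, hi, hip, hpi⟩
  choose s hs using fun j => hB.exists_eq_scalar_comp φ (hi j)
  have : IsSplitEpi φ := ⟨⟨∑ j, p j ≫ scalar (s j) A, by
    simp only [Preadditive.sum_comp, Category.assoc, ← hs, hpi]⟩⟩
  obtain ⟨j⟩ : Nonempty (Fin n) := by
    by_contra h
    rw [not_nonempty_iff] at h
    exact hB₀ ((Limits.IsZero.iff_id_eq_zero B).2 (hpi.symm.trans (Fintype.sum_empty _)))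
  have : IsSplitMono φ := ⟨⟨scalar (s j) B ≫ p j, by
    rw [← Category.assoc, ← scalar_naturality, ← hs, hip]⟩⟩
  exact isIso_of_mono_of_isSplitEpi φ

end Lagrangian

/-! ### Algebras in `𝒵(G, α)` -/

namespace Obj

section Algebra

open MonObj

variable {G k : Type u} [Group G] [Fintype G] [Field k] {α : Cocycle₃ G k}

lemma hom_one_apply {X : Obj α} (φ : one α ⟶ X) (c : k) :
    Hom.lin φ c = c • Hom.lin φ (1 : k) :=
  (congrArg (Hom.lin φ) (mul_one c).symm).trans (LinearMap.map_smul (Hom.lin φ) c (1 : k))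

lemma hom_one_ext {X : Obj α} {φ ψ : one α ⟶ X} (h : Hom.lin φ (1 : k) = Hom.lin ψ (1 : k)) :
    φ = ψ :=
  hom_ext (LinearMap.ext_ring h)

/-- The morphism out of the unit object given by an invariant vector of degree `1`. -/
def homOneOfInvariant {X : Obj α} {x : X} (hx : X.Homog 1 x) (hinv : ∀ f, X.act f x = x) :
    one α ⟶ X :=
  mkHom (LinearMap.toSpanSingleton k X x)
    (fun _ c hc => by
      obtain rfl | rfl := eq_one_or_eq_zero hc
      · exact hx.smul (show k from c)
      · exact (LinearMap.map_zero (LinearMap.toSpanSingleton k X x)).symm ▸ IsHomog.zero _ _)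
    (fun f _ c _ => by
      change (show k from c) • x = X.act f ((show k from c) • x)
      rw [map_smul, hinv])

lemma homOneOfInvariant_one {X : Obj α} {x : X} (hx : X.Homog 1 x)
    (hinv : ∀ f, X.act f x = x) : Hom.lin (homOneOfInvariant hx hinv) (1 : k) = x :=
  one_smul k x

variable {B : Obj α} [MonObj B]

lemma isHaploid_iff : IsHaploid B ↔
    ∀ b, B.Homog 1 b → (∀ f, B.act f b = b) → ∃ c : k, b = c • B.unitElt := by
  constructor
  · intro hB b hb hinv
    obtain ⟨s, hs⟩ := hB (homOneOfInvariant hb hinv)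
    refine ⟨Hom.lin s (1 : k), (homOneOfInvariant_one hb hinv).symm.trans ?_⟩
    rw [hs]
    exact hom_one_apply η[B] _
  · intro h φ
    obtain ⟨c, hc⟩ := h (Hom.lin φ (1 : k)) (map_homog φ (one_homog _))
      fun f => (Hom.map_act φ f (1 : k)).symm
    refine ⟨homOneOfInvariant (one_homog c) fun _ => rfl, hom_one_ext (hc.trans ?_)⟩
    refine (hom_one_apply η[B] c).symm.trans (congrArg (Hom.lin η[B]) ?_)
    exact (homOneOfInvariant_one (one_homog c) fun _ => rfl).symm

lemma isZero_iff_unitElt_eq_zero : Limits.IsZero B ↔ B.unitElt = 0 := by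
  rw [Limits.IsZero.iff_id_eq_zero]
  refine ⟨fun h => LinearMap.congr_fun (congrArg Hom.lin h) B.unitElt, fun h => hom_ext ?_⟩
  refine LinearMap.ext fun b => ?_
  rw [← unitElt_mul b, h, LinearMap.map_zero₂, map_zero, map_zero]

lemma mulBil_comm [IsCommMonObj B] {f : G} {a : B} (ha : B.Homog f a) (b : B) :
    B.mulBil a b = B.mulBil (B.act f b) a := by
  have h := LinearMap.congr_fun (congrArg Hom.lin (IsCommMonObj.mul_comm B)) (tm a b)
  exact h.symm.trans (congrArg (Hom.lin μ[B]) (braidIso_tm ha b))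

lemma mulBil_comm_one [IsCommMonObj B] {a : B} (ha : B.Homog 1 a) (b : B) :
    B.mulBil a b = B.mulBil b a := by
  rw [mulBil_comm ha, B.act_one, Module.End.one_apply]

lemma isCommMonObj_of_mulBil
    (h : ∀ f a, B.Homog f a → ∀ g b, B.Homog g b → B.mulBil a b = B.mulBil (B.act f b) a) :
    IsCommMonObj B where
  mul_comm := hom_ext <| tm_ext (X := B) (Y := B) fun f a ha g b hb =>
    (congrArg (Hom.lin μ[B]) (braidIso_tm ha b)).trans (h f a ha g b hb).symm

lemma isMonHom_of_mulBil {B' : Obj α} [MonObj B'] (φ : B ⟶ B')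
    (h_one : Hom.lin φ B.unitElt = B'.unitElt)
    (h_mul : ∀ f a, B.Homog f a → ∀ g b, B.Homog g b →
      Hom.lin φ (B.mulBil a b) = B'.mulBil (Hom.lin φ a) (Hom.lin φ b)) : IsMonHom φ where
  one_hom := hom_one_ext h_one
  mul_hom := hom_ext <| tm_ext (X := B) (Y := B) h_mul

end Algebra

/-! ### Frobenius reciprocity -/

section Transfer

variable {G k : Type u} [Group G] [Fintype G] [Field k] {α : Cocycle₃ G k}
  {H : Subgroup G} [Fintype H]

/-- The linear maps from an object of `𝒵(G, α)` to an object of `𝒵(H, α|_H)` that kill the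
components of degree outside `H` and are, on the others, graded and `H`-equivariant. They
correspond to morphisms `X ⟶ E(V)`, see `IsResHom.toTransfer`. -/
structure IsResHom {X : Obj α} {V : Obj (α.restrict H)} (φ : X →ₗ[k] V) : Prop where
  map_homog : ∀ {g : G} {x : X}, X.Homog g x → V.ExtHomog g (φ x)
  map_act : ∀ {g : G} {x : X}, X.Homog g x → ∀ h : H, φ (X.act h x) = V.act h (φ x)

namespace IsResHom

variable {X : Obj α} {V : Obj (α.restrict H)} {φ : X →ₗ[k] V}

/-- The map `x ↦ (g ↦ φ (g⁻¹.x))`. -/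
def toPi (φ : X →ₗ[k] V) : X →ₗ[k] (G → V) := LinearMap.pi fun g => φ ∘ₗ X.act g⁻¹

lemma toPi_apply (φ : X →ₗ[k] V) (x : X) (g : G) : toPi φ x g = φ (X.act g⁻¹ x) := rfl

lemma toPi_homog (hφ : IsResHom φ) {f : G} {x : X} (hx : X.Homog f x) :
    IsHomog V.mapProj f (toPi φ x) := by
  rw [mapHomog_iff]
  intro g
  have := hφ.map_homog (hx.act g⁻¹)
  rwa [inv_inv] at this

lemma toPi_mem (hφ : IsResHom φ) (x : X) : toPi φ x ∈ V.transferSubmodule := by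
  rw [← sum_proj X.grading x, map_sum]
  refine Submodule.sum_mem _ fun f _ => ?_
  have hx := isHomog_proj X.grading f x
  refine (mem_transfer_iff (hφ.toPi_homog hx)).2 fun g h => ?_
  rw [toPi_apply, toPi_apply, mul_inv_rev, hx.act_mul, map_smul, ← hφ.map_act (hx.act g⁻¹)]
  rfl

/-- The morphism adjoint to `φ`. -/
def toTransfer (hφ : IsResHom φ) : X ⟶ V.transfer :=
  mkHom ((toPi φ).codRestrict _ hφ.toPi_mem)
    (fun _ _ hx => Subtype.ext (hφ.toPi_homog hx))
    (fun f _ x hx => Subtype.ext <| funext fun g => by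
      change toPi φ (X.act f x) g = V.mapAct f (toPi φ x) g
      rw [mapAct_apply (hφ.toPi_homog hx), toPi_apply, toPi_apply, mul_inv_rev, inv_inv,
        hx.act_mul, map_smul, smul_smul, Units.inv_mul, one_smul])

end IsResHom

omit [Fintype G] in
lemma extHomog_coe_iff {V : Obj (α.restrict H)} {h : H} {v : V} :
    V.ExtHomog h v ↔ V.Homog h v := by
  rw [ExtHomog, Homog, IsHomog, IsHomog, extProj, dif_pos h.2]

lemma transfer_act_val {V : Obj (α.restrict H)} (g : G) (v : V.transfer) :
    (V.transfer.act g v).1 = V.mapAct g v.1 := rfl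

lemma transfer_eq_const {V : Obj (α.restrict H)} {v : V.transfer} (hv : V.transfer.Homog 1 v)
    (hinv : ∀ g, V.transfer.act g v = v) (x : G) : v.1 x = v.1 1 := by
  have h := congrFun (congrArg Subtype.val (hinv x)) x
  rw [transfer_act_val, mapAct_apply (show IsHomog V.mapProj 1 v.1 from Subtype.ext_iff.1 hv)] at h
  simpa using h.symm

section Algebra

variable {A : Obj (α.restrict H)} [MonObj A]

lemma transfer_mulBil_val (a b : A.transfer) : (A.transfer.mulBil a b).1 = A.mapMul a.1 b.1 := rfl

lemma transfer_unitElt_val : A.transfer.unitElt.1 = fun _ => A.unitElt :=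
  one_smul k (fun _ : G => A.unitElt)

theorem IsResHom.isMonHom_toTransfer {B : Obj α} [MonObj B] {φ : B →ₗ[k] A} (hφ : IsResHom φ)
    (map_unit : φ B.unitElt = A.unitElt)
    (map_mul : ∀ f a, B.Homog f a → ∀ g b, B.Homog g b →
      φ (B.mulBil a b) = A.mulBil (φ a) (φ b)) : IsMonHom hφ.toTransfer := by
  refine isMonHom_of_mulBil hφ.toTransfer (Subtype.ext <| funext fun x => ?_)
    fun f a ha g b hb => Subtype.ext <| funext fun x => ?_
  · change toPi φ B.unitElt x = A.transfer.unitElt.1 x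
    rw [transfer_unitElt_val, toPi_apply, act_unitElt, map_unit]
  · change toPi φ (B.mulBil a b) x = A.mapMul (toPi φ a) (toPi φ b) x
    rw [mapMul_apply (hφ.toPi_homog ha) (hφ.toPi_homog hb), toPi_apply, act_mulBil ha hb,
      map_smul, map_mul _ _ (ha.act _) _ _ (hb.act _)]
    rfl

/-! ### The algebra `L(H, γ)` -/

lemma transfer_unitElt_ne_zero (h : A.unitElt ≠ 0) : A.transfer.unitElt ≠ 0 := fun e =>
  h (congrFun (transfer_unitElt_val.symm.trans (congrArg Subtype.val e)) 1)

instance transfer_isCommMonObj [IsCommMonObj A] : IsCommMonObj A.transfer :=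
  isCommMonObj_of_mulBil fun f a ha g b hb => Subtype.ext <| funext fun x => by
    rw [transfer_homog_iff] at ha hb
    rw [transfer_mulBil_val, transfer_mulBil_val, transfer_act_val,
      mapMul_apply ha hb, mapMul_apply (mapHomog_act hb f) ha, mapAct_apply hb]
    obtain hax | ⟨h, hh, hax⟩ := (mapHomog_iff.1 ha x).cases
    · rw [hax, LinearMap.map_zero₂, map_zero, smul_zero, smul_zero]
    have hx : f⁻¹ * x = x * (h⁻¹ : H) := by
      rw [InvMemClass.coe_inv, hh]
      group
    have hα := α.coslant_mul_slant x⁻¹ f g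
    rw [inv_inv, ← hh] at hα
    rw [hx, (mem_transfer_iff hb).1 b.2, mulBil_comm hax, inv_inv]
    simp only [map_smul, LinearMap.smul_apply, smul_smul, ← Units.val_mul]
    congr 2
    rw [InvMemClass.coe_inv, inv_inv, mul_left_comm, ← hα,
      mul_comm (α.coslant _ _ _), inv_mul_cancel_left]

lemma isHaploid_transfer (hA : IsHaploid A) : IsHaploid A.transfer := by
  rw [isHaploid_iff] at hA ⊢
  intro a ha hinv
  have ha' := transfer_homog_iff.1 ha
  have ha₁ : A.Homog 1 (a.1 1) := extHomog_coe_iff.1 (by simpa using mapHomog_iff.1 ha' 1)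
  obtain ⟨c, hc⟩ := hA (a.1 1) ha₁ fun h => by
    have := (mem_transfer_iff ha').1 a.2 1 h⁻¹
    rw [α.slant_one_right, Units.val_one, one_smul, inv_inv, transfer_eq_const ha hinv] at this
    exact this.symm
  refine ⟨c, Subtype.ext <| funext fun x => ?_⟩
  change a.1 x = c • A.transfer.unitElt.1 x
  rw [transfer_eq_const ha hinv, hc, transfer_unitElt_val]

end Algebra

end Transfer

end Obj

namespace Cochain₂

variable {G k : Type u} [Group G] [Fintype G] [Field k] {α : Cocycle₃ G k} {γ : Cochain₂ G k}
  (hγ : γ.d = α)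

/-- The basis vector `e_g`, as an element of the object `k[G, γ]`. -/
def basisElt (g : G) : γ.groupAlgebra hγ := (e g : G → k)

lemma mulBil_basisElt (f g : G) :
    (γ.groupAlgebra hγ).mulBil (basisElt hγ f) (basisElt hγ g) =
      (γ f g : k) • basisElt hγ (f * g) :=
  γ.algMul_e f g

lemma act_basisElt (f g : G) :
    (γ.groupAlgebra hγ).act f (basisElt hγ g) = (γ.eps f g : k) • basisElt hγ (f * g * f⁻¹) :=
  γ.algAct_e f g

lemma basisElt_homog (g : G) : (γ.groupAlgebra hγ).Homog g (basisElt hγ g) :=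
  isHomog_e g

lemma unitElt_eq_basisElt : (γ.groupAlgebra hγ).unitElt = basisElt hγ 1 :=
  one_smul k (basisElt hγ 1)

variable {hγ} in
lemma exists_eq_smul_basisElt {g : G} {v : γ.groupAlgebra hγ}
    (hv : (γ.groupAlgebra hγ).Homog g v) : ∃ c : k, v = c • basisElt hγ g :=
  ⟨_, eq_smul_e hv⟩

lemma basisElt_ne_zero (g : G) : basisElt hγ g ≠ 0 :=
  show (e g : G → k) ≠ 0 by classical exact Pi.single_ne_zero_iff.2 one_ne_zero

instance : IsCommMonObj (γ.groupAlgebra hγ) :=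
  Obj.isCommMonObj_of_mulBil fun f a ha g b hb => by
    obtain ⟨c, rfl⟩ := exists_eq_smul_basisElt ha
    obtain ⟨d, rfl⟩ := exists_eq_smul_basisElt hb
    simp only [map_smul, LinearMap.smul_apply, act_basisElt, mulBil_basisElt, smul_smul,
      inv_mul_cancel_right]
    rw [mul_assoc d, ← Units.val_mul, eps, div_mul_cancel, mul_left_comm]

lemma isHaploid_groupAlgebra : IsHaploid (γ.groupAlgebra hγ) :=
  Obj.isHaploid_iff.2 fun _ hb _ => by
    rw [unitElt_eq_basisElt]
    exact exists_eq_smul_basisElt hb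

end Cochain₂

section LagrangianAlgebra

variable {G k : Type u} [Group G] [Fintype G] [Field k] {α : Cocycle₃ G k} {H : Subgroup G}
  {γ : Cochain₂ H k} (hγ : γ.d = α.restrict H)

instance : IsCommMonObj (lagrangianAlgebra α H γ hγ).X :=
  letI : Fintype H := Fintype.ofFinite H
  Obj.transfer_isCommMonObj

lemma isHaploid_lagrangianAlgebra : IsHaploid (lagrangianAlgebra α H γ hγ).X :=
  letI : Fintype H := Fintype.ofFinite H
  Obj.isHaploid_transfer (Cochain₂.isHaploid_groupAlgebra hγ)

lemma not_isZero_lagrangianAlgebra : ¬ Limits.IsZero (lagrangianAlgebra α H γ hγ).X := by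
  let : Fintype H := Fintype.ofFinite H
  rw [Obj.isZero_iff_unitElt_eq_zero]
  refine Obj.transfer_unitElt_ne_zero (A := γ.groupAlgebra hγ) ?_
  rw [Cochain₂.unitElt_eq_basisElt]
  exact Cochain₂.basisElt_ne_zero hγ 1

end LagrangianAlgebra

/-! ### Characters of the neutral component -/

lemma nonempty_algHom_of_isIntegral (k R : Type*) [Field k] [IsAlgClosed k] [CommRing R]
    [Nontrivial R] [Algebra k R] [Algebra.IsIntegral k R] : Nonempty (R →ₐ[k] k) := by
  obtain ⟨m, hm⟩ := Ideal.exists_maximal R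
  exact ⟨(IsAlgClosed.lift : (R ⧸ m) →ₐ[k] k).comp (Ideal.Quotient.mkₐ k m)⟩

namespace Obj

variable {G k : Type u} [Group G] [Fintype G] [Field k] {α : Cocycle₃ G k} {B : Obj α}

/-- The component of degree `1` of an object; for a commutative algebra it is a commutative ring
with the product of the algebra, since the braiding and the associativity constraint are trivial
on it. -/
def neutralComponent (B : Obj α) : Submodule k B := LinearMap.eqLocus (B.proj 1) LinearMap.id

instance : FiniteDimensional k B.neutralComponent :=
  FiniteDimensional.finiteDimensional_submodule _

variable [MonObj B]

lemma mulBil_homog_one {a b : B} (ha : B.Homog 1 a) (hb : B.Homog 1 b) :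
    B.Homog 1 (B.mulBil a b) := by
  simpa using mulBil_homog ha hb

lemma mulBil_assoc_one_left {g h : G} {a b c : B} (ha : B.Homog 1 a) (hb : B.Homog g b)
    (hc : B.Homog h c) : B.mulBil a (B.mulBil b c) = B.mulBil (B.mulBil a b) c := by
  rw [mulBil_assoc ha hb hc, α.one_left, Units.val_one, one_smul]

lemma mulBil_assoc_one_mid {f h : G} {a b c : B} (ha : B.Homog f a) (hb : B.Homog 1 b)
    (hc : B.Homog h c) : B.mulBil a (B.mulBil b c) = B.mulBil (B.mulBil a b) c := by
  rw [mulBil_assoc ha hb hc, α.one_mid, Units.val_one, one_smul]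

lemma mulBil_assoc_one_right {f g : G} {a b c : B} (ha : B.Homog f a) (hb : B.Homog g b)
    (hc : B.Homog 1 c) : B.mulBil a (B.mulBil b c) = B.mulBil (B.mulBil a b) c := by
  rw [mulBil_assoc ha hb hc, α.one_right, Units.val_one, one_smul]

variable [IsCommMonObj B]

lemma mulBil_left_comm_one {f g : G} {a b c : B} (ha : B.Homog f a) (hb : B.Homog 1 b)
    (hc : B.Homog g c) : B.mulBil a (B.mulBil b c) = B.mulBil b (B.mulBil a c) := by
  rw [mulBil_assoc_one_mid ha hb hc, ← mulBil_comm_one hb, mulBil_assoc_one_left hb ha hc]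

instance : CommRing B.neutralComponent :=
  { (inferInstance : AddCommGroup B.neutralComponent) with
    mul := fun a b => ⟨B.mulBil a b, mulBil_homog_one a.2 b.2⟩
    one := ⟨B.unitElt, unitElt_homog⟩
    left_distrib := fun a b c => Subtype.ext (map_add (B.mulBil a.1) b.1 c.1)
    right_distrib := fun a b c => Subtype.ext (LinearMap.map_add₂ B.mulBil a.1 b.1 c.1)
    zero_mul := fun a => Subtype.ext (LinearMap.map_zero₂ B.mulBil a.1)
    mul_zero := fun a => Subtype.ext (map_zero (B.mulBil a.1))
    mul_assoc := fun a b c => Subtype.ext (mulBil_assoc_one_left a.2 b.2 c.2).symm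
    one_mul := fun a => Subtype.ext (unitElt_mul a.1)
    mul_one := fun a => Subtype.ext (mul_unitElt a.1)
    mul_comm := fun a b => Subtype.ext (mulBil_comm_one a.2 b.1) }

instance : Algebra k B.neutralComponent :=
  Algebra.ofModule (fun c a b => Subtype.ext (LinearMap.map_smul₂ B.mulBil c a.1 b.1))
    (fun c a b => Subtype.ext (map_smul (B.mulBil a.1) c b.1))

variable (B) in
/-- A character of the component of degree `1` of a commutative algebra in `𝒵(G, α)`. -/
abbrev NeutralChar : Type u := B.neutralComponent →ₐ[k] k

lemma nonempty_neutralChar [IsAlgClosed k] (hB : ¬ Limits.IsZero B) : Nonempty (NeutralChar B) := by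
  rw [isZero_iff_unitElt_eq_zero] at hB
  have : Nontrivial B.neutralComponent := ⟨1, 0, fun h => hB (congrArg Subtype.val h)⟩
  exact nonempty_algHom_of_isIntegral k _

namespace NeutralChar

variable (χ : NeutralChar B)

/-- The extension of `χ` to a linear form on `B` that vanishes in the degrees other than `1`. -/
def form : B →ₗ[k] k :=
  χ.toLinearMap ∘ₗ (B.proj 1).codRestrict B.neutralComponent (isHomog_proj B.grading 1)

lemma form_of_homog {a : B} (ha : B.Homog 1 a) : χ.form a = χ ⟨a, ha⟩ :=
  congrArg χ (Subtype.ext ha)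

lemma form_of_ne {g : G} (hg : g ≠ 1) {a : B} (ha : B.Homog g a) : χ.form a = 0 := by
  classical
  refine (congrArg χ (Subtype.ext ?_)).trans (map_zero χ)
  exact (ha.proj_eq B.grading 1).trans (if_neg hg.symm)

lemma form_unitElt : χ.form B.unitElt = 1 :=
  (χ.form_of_homog unitElt_homog).trans (map_one χ)

lemma form_mulBil {a b : B} (ha : B.Homog 1 a) (hb : B.Homog 1 b) :
    χ.form (B.mulBil a b) = χ.form a * χ.form b := by
  rw [χ.form_of_homog ha, χ.form_of_homog hb, χ.form_of_homog (mulBil_homog_one ha hb), ← map_mul]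
  rfl

/-- The bilinear form `(a, b) ↦ χ (ab)`. Its values on vectors of degrees `g⁻¹` and `g` have rank at
most one, see `pairing_eq_coeff_mul`. -/
def pairing : B →ₗ[k] B →ₗ[k] k := B.mulBil.compr₂ χ.form

lemma pairing_apply (a b : B) : χ.pairing a b = χ.form (B.mulBil a b) := rfl

lemma pairing_mulBil_right {f g h : G} {a b c : B} (ha : B.Homog f a) (hb : B.Homog g b)
    (hc : B.Homog h c) :
    χ.pairing a (B.mulBil b c) = α f g h * χ.pairing (B.mulBil a b) c := by
  rw [pairing_apply, mulBil_assoc ha hb hc, map_smul, smul_eq_mul, pairing_apply]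

lemma pairing_unitElt_unitElt : χ.pairing B.unitElt B.unitElt = 1 := by
  rw [pairing_apply, unitElt_mul, form_unitElt]

lemma pairing_exchange {g : G} {a b c d : B} (ha : B.Homog g⁻¹ a) (hb : B.Homog g b)
    (hc : B.Homog g⁻¹ c) (hd : B.Homog g d) :
    χ.pairing a b * χ.pairing c d = α g g⁻¹ g * (χ.pairing b c * χ.pairing a d) := by
  have hab : B.Homog 1 (B.mulBil a b) := by simpa using mulBil_homog ha hb
  have hcd : B.Homog 1 (B.mulBil c d) := by simpa using mulBil_homog hc hd
  have hbc : B.Homog 1 (B.mulBil b c) := by simpa using mulBil_homog hb hc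
  have had : B.Homog 1 (B.mulBil a d) := by simpa using mulBil_homog ha hd
  calc χ.pairing a b * χ.pairing c d
    _ = χ.pairing a (B.mulBil b (B.mulBil c d)) := by
      rw [pairing_apply, pairing_apply, ← χ.form_mulBil hab hcd,
        ← mulBil_assoc_one_right ha hb hcd, pairing_apply]
    _ = α g g⁻¹ g * χ.pairing a (B.mulBil (B.mulBil b c) d) := by
      rw [mulBil_assoc hb hc hd, map_smul, smul_eq_mul]
    _ = α g g⁻¹ g * (χ.pairing b c * χ.pairing a d) := by
      rw [pairing_apply, mulBil_left_comm_one ha hbc hd, χ.form_mulBil hbc had, pairing_apply,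
        pairing_apply]

lemma pairing_mul_pairing {g h : G} {y u z v : B} (hy : B.Homog g⁻¹ y) (hu : B.Homog g u)
    (hz : B.Homog h⁻¹ z) (hv : B.Homog h v) :
    α g⁻¹ g h * (χ.pairing y u * χ.pairing z v) =
      α h⁻¹ g⁻¹ (g * h) * χ.pairing (B.mulBil z y) (B.mulBil u v) := by
  have hyu : B.Homog 1 (B.mulBil y u) := by simpa using mulBil_homog hy hu
  have hzv : B.Homog 1 (B.mulBil z v) := by simpa using mulBil_homog hz hv
  calc α g⁻¹ g h * (χ.pairing y u * χ.pairing z v)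
    _ = α g⁻¹ g h * χ.pairing z (B.mulBil (B.mulBil y u) v) := by
      rw [χ.pairing_apply z (B.mulBil (B.mulBil y u) v), mulBil_left_comm_one hz hyu hv,
        χ.form_mulBil hyu hzv, pairing_apply, pairing_apply]
    _ = χ.pairing z (B.mulBil y (B.mulBil u v)) := by
      rw [mulBil_assoc hy hu hv, map_smul, smul_eq_mul]
    _ = α h⁻¹ g⁻¹ (g * h) * χ.pairing (B.mulBil z y) (B.mulBil u v) :=
      χ.pairing_mulBil_right hz hy (mulBil_homog hu hv)

/-- The degrees in which `χ.pairing` does not vanish. -/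
def support : Subgroup G where
  carrier := {g | ∃ y u, B.Homog g⁻¹ y ∧ B.Homog g u ∧ χ.pairing y u ≠ 0}
  one_mem' := ⟨B.unitElt, B.unitElt, by simpa using unitElt_homog, unitElt_homog,
    by simp [pairing_unitElt_unitElt]⟩
  mul_mem' := by
    rintro g h ⟨y, u, hy, hu, hyu⟩ ⟨z, v, hz, hv, hzv⟩
    refine ⟨B.mulBil z y, B.mulBil u v, ?_, mulBil_homog hu hv, fun h₀ => ?_⟩
    · rw [mul_inv_rev]
      exact mulBil_homog hz hy
    · have := χ.pairing_mul_pairing hy hu hz hv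
      rw [h₀, mul_zero] at this
      exact mul_ne_zero (Units.ne_zero _) (mul_ne_zero hyu hzv) this
  inv_mem' := by
    rintro g ⟨y, u, hy, hu, hyu⟩
    refine ⟨u, y, by rwa [inv_inv], hy, fun h₀ => ?_⟩
    have := χ.pairing_exchange hy hu hy hu
    rw [h₀, zero_mul, mul_zero] at this
    exact mul_ne_zero hyu hyu this

lemma pairing_eq_zero {g : G} (hg : g ∉ χ.support) {z b : B} (hz : B.Homog g⁻¹ z)
    (hb : B.Homog g b) : χ.pairing z b = 0 :=
  not_not.1 fun h => hg ⟨z, b, hz, hb, h⟩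

lemma exists_dual (n : χ.support) : ∃ p : B × B, B.Homog (n : G)⁻¹ p.1 ∧ B.Homog (n : G) p.2 ∧
    χ.pairing p.1 p.2 = 1 ∧ (n = 1 → p.2 = B.unitElt) := by
  by_cases hn : n = 1
  · subst hn
    exact ⟨(B.unitElt, B.unitElt), by simpa using unitElt_homog, unitElt_homog,
      χ.pairing_unitElt_unitElt, fun _ => rfl⟩
  · obtain ⟨y, u, hy, hu, h⟩ := n.2
    refine ⟨((χ.pairing y u)⁻¹ • y, u), hy.smul _, hu, ?_, fun e => absurd e hn⟩
    rw [LinearMap.map_smul₂, smul_eq_mul, inv_mul_cancel₀ h]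

/-- A vector of degree `n` that spans the component of degree `n` modulo the radical of
`χ.pairing`. It is the unit for `n = 1`, so that the cochain of structure constants with respect to
these vectors is normalised. -/
def vec (n : χ.support) : B := (χ.exists_dual n).choose.2

/-- A vector of degree `n⁻¹` dual to `χ.vec n`. -/
def covec (n : χ.support) : B := (χ.exists_dual n).choose.1

lemma covec_homog (n : χ.support) : B.Homog (n : G)⁻¹ (χ.covec n) :=
  (χ.exists_dual n).choose_spec.1

lemma vec_homog (n : χ.support) : B.Homog (n : G) (χ.vec n) :=
  (χ.exists_dual n).choose_spec.2.1

lemma vec_one : χ.vec 1 = B.unitElt := (χ.exists_dual 1).choose_spec.2.2.2 rfl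

/-- The coefficient of a vector of degree `n` with respect to `χ.vec n`, modulo the radical of
`χ.pairing`. -/
def coeff (n : χ.support) : B →ₗ[k] k := χ.pairing (χ.covec n)

lemma coeff_vec (n : χ.support) : χ.coeff n (χ.vec n) = 1 :=
  (χ.exists_dual n).choose_spec.2.2.1

lemma coeff_of_ne {n : χ.support} {g : G} (h : (n : G) ≠ g) {b : B} (hb : B.Homog g b) :
    χ.coeff n b = 0 :=
  χ.form_of_ne (fun e => h (inv_mul_eq_one.1 e)) (mulBil_homog (χ.covec_homog n) hb)

lemma pairing_eq_coeff_mul (n : χ.support) {z b : B} (hz : B.Homog (n : G)⁻¹ z)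
    (hb : B.Homog (n : G) b) : χ.pairing z b = χ.coeff n b * χ.pairing z (χ.vec n) := by
  have h₁ := χ.pairing_exchange hz hb (χ.covec_homog n) (χ.vec_homog n)
  have h₂ := χ.pairing_exchange (χ.covec_homog n) hb (χ.covec_homog n) (χ.vec_homog n)
  rw [← coeff, coeff_vec, mul_one] at h₁ h₂
  rw [h₁, h₂, mul_one, mul_assoc]

lemma coeff_mulBil_right {p n : χ.support} {f : G} (hp : (p : G) = f * n) {a b : B}
    (ha : B.Homog f a) (hb : B.Homog (n : G) b) :
    χ.coeff p (B.mulBil a b) = χ.coeff n b * χ.coeff p (B.mulBil a (χ.vec n)) := by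
  have hpa : B.Homog (n : G)⁻¹ (B.mulBil (χ.covec p) a) := by
    simpa [hp] using mulBil_homog (χ.covec_homog p) ha
  rw [coeff, χ.pairing_mulBil_right (χ.covec_homog p) ha hb, χ.pairing_eq_coeff_mul n hpa hb,
    χ.pairing_mulBil_right (χ.covec_homog p) ha (χ.vec_homog n), mul_left_comm]

lemma coeff_mulBil_left {p m : χ.support} {g : G} (hp : (p : G) = m * g) {a b : B}
    (ha : B.Homog (m : G) a) (hb : B.Homog g b) :
    χ.coeff p (B.mulBil a b) = χ.coeff m a * χ.coeff p (B.mulBil (χ.vec m) b) := by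
  rw [mulBil_comm ha, mulBil_comm (χ.vec_homog m)]
  exact χ.coeff_mulBil_right (by simp [hp]) (hb.act m) ha

lemma coeff_mulBil_of_notMem {n : χ.support} {f g : G} (hg : g ∉ χ.support) {a b : B}
    (ha : B.Homog f a) (hb : B.Homog g b) : χ.coeff n (B.mulBil a b) = 0 := by
  by_cases hn : (n : G) = f * g
  · rw [coeff, χ.pairing_mulBil_right (χ.covec_homog n) ha hb, χ.pairing_eq_zero hg _ hb, mul_zero]
    simpa [hn] using mulBil_homog (χ.covec_homog n) ha
  · exact χ.coeff_of_ne hn (mulBil_homog ha hb)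

lemma coeff_vec_mul_vec_ne_zero (m n : χ.support) :
    χ.coeff (m * n) (B.mulBil (χ.vec m) (χ.vec n)) ≠ 0 := by
  intro h₀
  have hz : B.Homog ((m * n : χ.support) : G)⁻¹ (B.mulBil (χ.covec n) (χ.covec m)) := by
    simpa using mulBil_homog (χ.covec_homog n) (χ.covec_homog m)
  have h := χ.pairing_mul_pairing (χ.covec_homog m) (χ.vec_homog m) (χ.covec_homog n)
    (χ.vec_homog n)
  rw [← coeff, ← coeff, coeff_vec, coeff_vec, mul_one, mul_one,
    χ.pairing_eq_coeff_mul (m * n) hz (mulBil_homog (χ.vec_homog m) (χ.vec_homog n)), h₀, zero_mul,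
    mul_zero] at h
  exact Units.ne_zero _ h

/-- The cochain of structure constants with respect to the vectors `χ.vec n`. -/
def cochain : Cochain₂ χ.support k where
  toFun m n := Units.mk0 _ (χ.coeff_vec_mul_vec_ne_zero m n)
  one_left n := Units.ext <| by
    rw [Units.val_mk0, one_mul, vec_one, unitElt_mul, coeff_vec, Units.val_one]
  one_right n := Units.ext <| by
    rw [Units.val_mk0, mul_one, vec_one, mul_unitElt, coeff_vec, Units.val_one]

lemma coeff_mulBil (m n : χ.support) {a b : B} (ha : B.Homog (m : G) a) (hb : B.Homog (n : G) b) :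
    χ.coeff (m * n) (B.mulBil a b) = χ.cochain m n * (χ.coeff m a * χ.coeff n b) := by
  rw [χ.coeff_mulBil_left rfl ha hb, χ.coeff_mulBil_right rfl (χ.vec_homog m) hb, mul_comm,
    mul_comm (χ.coeff n b), mul_assoc, mul_comm (χ.coeff n b)]
  rfl

lemma cochain_d : χ.cochain.d = α.restrict χ.support := by
  funext f g h
  have hf := χ.vec_homog f
  have hg := χ.vec_homog g
  have hh := χ.vec_homog h
  have e := congrArg (χ.coeff (f * g * h)) (mulBil_assoc hf hg hh)
  rw [map_smul, χ.coeff_mulBil (f * g) h (mulBil_homog hf hg) hh, χ.coeff_mulBil f g hf hg,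
    mul_assoc, χ.coeff_mulBil f (g * h) hf (mulBil_homog hg hh), χ.coeff_mulBil g h hg hh] at e
  simp only [coeff_vec, mul_one, one_mul, smul_eq_mul, ← Units.val_mul] at e
  have e' := Units.ext e
  change χ.cochain.d f g h = α f g h
  rw [Cochain₂.d, mul_inv_eq_iff_eq_mul, mul_right_comm, mul_inv_eq_iff_eq_mul,
    mul_comm (χ.cochain g h), e']
  ac_rfl

section toGroupAlgebra

variable [Fintype χ.support]

/-- The algebra `k[H, γ]` for the support `H` of `χ` and the cochain `γ` of structure constants. -/
abbrev groupAlgebra : Obj (α.restrict χ.support) := χ.cochain.groupAlgebra χ.cochain_d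

/-- The linear map that takes `χ.vec n` to `e_n` and kills the radical of `χ.pairing`. -/
def toGroupAlgebra : B →ₗ[k] χ.groupAlgebra := LinearMap.pi χ.coeff

lemma toGroupAlgebra_of_mem {n : χ.support} {b : B} (hb : B.Homog (n : G) b) :
    χ.toGroupAlgebra b = χ.coeff n b • Cochain₂.basisElt χ.cochain_d n := by
  classical
  refine funext (α := χ.support) (β := fun _ => k) fun m => ?_
  change χ.coeff m b = χ.coeff n b * (Cochain₂.e n : χ.support → k) m
  by_cases h : m = n
  · simp [h, Cochain₂.e]
  · rw [χ.coeff_of_ne (fun e => h (Subtype.ext e)) hb]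
    simp [Cochain₂.e, h]

lemma toGroupAlgebra_of_notMem {g : G} (hg : g ∉ χ.support) {b : B} (hb : B.Homog g b) :
    χ.toGroupAlgebra b = 0 :=
  funext (α := χ.support) (β := fun _ => k) fun m =>
    χ.coeff_of_ne (ne_of_mem_of_not_mem m.2 hg) hb

lemma toGroupAlgebra_unitElt : χ.toGroupAlgebra B.unitElt = χ.groupAlgebra.unitElt := by
  rw [χ.toGroupAlgebra_of_mem (n := 1) unitElt_homog, ← vec_one, coeff_vec, one_smul,
    Cochain₂.unitElt_eq_basisElt]

lemma toGroupAlgebra_mulBil {f g : G} {a b : B} (ha : B.Homog f a) (hb : B.Homog g b) :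
    χ.toGroupAlgebra (B.mulBil a b) =
      χ.groupAlgebra.mulBil (χ.toGroupAlgebra a) (χ.toGroupAlgebra b) := by
  by_cases hg : g ∈ χ.support
  · by_cases hf : f ∈ χ.support
    · lift f to χ.support using hf
      lift g to χ.support using hg
      rw [χ.toGroupAlgebra_of_mem ha, χ.toGroupAlgebra_of_mem hb,
        χ.toGroupAlgebra_of_mem (n := f * g) (mulBil_homog ha hb), χ.coeff_mulBil f g ha hb,
        map_smul, LinearMap.map_smul₂, Cochain₂.mulBil_basisElt, smul_smul, smul_smul]
      congr 1
      ring
    · rw [χ.toGroupAlgebra_of_notMem hf ha, LinearMap.map_zero₂]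
      exact χ.toGroupAlgebra_of_notMem (mt (mul_mem_cancel_right hg).1 hf) (mulBil_homog ha hb)
  · rw [χ.toGroupAlgebra_of_notMem hg hb, map_zero]
    exact funext (α := χ.support) (β := fun _ => k) fun n => χ.coeff_mulBil_of_notMem hg ha hb

lemma toGroupAlgebra_act {g : G} {b : B} (hb : B.Homog g b) (h : χ.support) :
    χ.toGroupAlgebra (B.act h b) = χ.groupAlgebra.act h (χ.toGroupAlgebra b) := by
  by_cases hg : g ∈ χ.support
  · lift g to χ.support using hg
    rw [χ.toGroupAlgebra_of_mem hb, χ.toGroupAlgebra_of_mem (n := h * g * h⁻¹) (hb.act h),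
      map_smul, Cochain₂.act_basisElt, smul_smul]
    congr 1
    have h₁ := χ.coeff_mulBil h g (χ.vec_homog h) hb
    have h₂ := χ.coeff_mulBil (h * g * h⁻¹) h (hb.act h) (χ.vec_homog h)
    rw [inv_mul_cancel_right, ← mulBil_comm (χ.vec_homog h), h₁] at h₂
    simp only [coeff_vec, one_mul, mul_one] at h₂
    rw [Cochain₂.eps, Units.val_div_eq_div_val, ← mul_div_assoc, eq_div_iff (Units.ne_zero _)]
    linear_combination -h₂
  · rw [χ.toGroupAlgebra_of_notMem hg hb, map_zero]
    refine χ.toGroupAlgebra_of_notMem (fun h' => hg ?_) (hb.act h)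
    simpa [mul_assoc] using mul_mem (mul_mem (inv_mem h.2) h') h.2

lemma isResHom_toGroupAlgebra : IsResHom χ.toGroupAlgebra where
  map_homog {g b} hb := by
    by_cases hg : g ∈ χ.support
    · lift g to χ.support using hg
      rw [χ.toGroupAlgebra_of_mem hb]
      exact (Homog.ext (Cochain₂.basisElt_homog χ.cochain_d g)).smul _
    · rw [χ.toGroupAlgebra_of_notMem hg hb]
      exact IsHomog.zero _ _
  map_act hb h := χ.toGroupAlgebra_act hb h

end toGroupAlgebra

end NeutralChar

end Obj

theorem exists_hom_lagrangianAlgebra {G k : Type u} [Group G] [Fintype G] [Field k]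
    [IsAlgClosed k] {α : Cocycle₃ G k} (B : Mon (Obj α)) [IsCommMonObj B.X]
    (hB : ¬ Limits.IsZero B.X) :
    ∃ (H : Subgroup G) (γ : Cochain₂ H k) (hγ : γ.d = α.restrict H),
      Nonempty (B ⟶ lagrangianAlgebra α H γ hγ) := by
  obtain ⟨χ⟩ := Obj.nonempty_neutralChar hB
  let : Fintype χ.support := Fintype.ofFinite χ.support
  have : IsMonHom χ.isResHom_toGroupAlgebra.toTransfer :=
    χ.isResHom_toGroupAlgebra.isMonHom_toTransfer χ.toGroupAlgebra_unitElt
      fun _ _ ha _ _ hb => χ.toGroupAlgebra_mulBil ha hb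
  exact ⟨χ.support, χ.cochain, χ.cochain_d,
    ⟨{ hom := χ.isResHom_toGroupAlgebra.toTransfer, isMonHom_hom := this }⟩⟩

end TwistedCentre

end

theorem mainTheorem1_general {k G : Type u} [Field k] [IsAlgClosed k] [Group G] [Fintype G]
    (α : TwistedCentre.Cocycle₃ G k) (L : CategoryTheory.Mon (TwistedCentre.Obj α))
    (hL : TwistedCentre.IsLagrangian L.X) :
    ∃ (H : Subgroup G) (γ : TwistedCentre.Cochain₂ H k) (hγ : γ.d = α.restrict H),
      Nonempty (L ≅ TwistedCentre.lagrangianAlgebra α H γ hγ) := by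
  have := hL.comm
  obtain ⟨H, γ, hγ, ⟨φ⟩⟩ := TwistedCentre.exists_hom_lagrangianAlgebra L hL.nonzero
  have : CategoryTheory.IsIso ((CategoryTheory.Mon.forget _).map φ) :=
    hL.isIso (TwistedCentre.isHaploid_lagrangianAlgebra hγ)
      (TwistedCentre.not_isZero_lagrangianAlgebra hγ) φ.hom
  have : CategoryTheory.IsIso φ :=
    CategoryTheory.isIso_of_reflects_iso φ (CategoryTheory.Mon.forget _)
  exact ⟨H, γ, hγ, ⟨CategoryTheory.asIso φ⟩⟩

theorem mainTheorem1 {k G : Type u} [Field k] [IsAlgClosed k] [CharZero k] [Group G] [Fintype G]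
    (α : TwistedCentre.Cocycle₃ G k) (L : CategoryTheory.Mon (TwistedCentre.Obj α))
    (hL : TwistedCentre.IsLagrangian L.X) :
    ∃ (H : Subgroup G) (γ : TwistedCentre.Cochain₂ H k) (hγ : γ.d = α.restrict H),
      Nonempty (L ≅ TwistedCentre.lagrangianAlgebra α H γ hγ) :=
  mainTheorem1_general α L hL
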